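/- Let $k$ be an algebraically closed field of characteristic different from $2$, let $n,r\ge 1$ be integers, and let $V=k^n$ be equipped with a nondegenerate bilinear form $\langle\cdot,\cdot\rangle$ that is either symmetric or skew-symmetric. Let $\rho$ be the adjoint involution of $\operatorname{End}_k(V)$, $\rho(A)=\phi^{-1}\circ A^*\circ\phi$ with $\phi:V\to V^*$, $\phi(v)(w)=\langle v,w\rangle$. For a subspace $W\subseteq V$ put $W^\perp=\{x\in V:\langle w,x\rangle=0\ \forall w\in W\}$, call $\dim_k(W\cap W^\perp)$ the isotropy rank of $W$, and let $Z(W,r;V)\subseteq\operatorname{End}_k(V)^r$ be the set of $r$-tuples $(A_1,\dots,A_r)$ with $A_iW\subseteq W$ and $\rho(A_i)W\subseteq W$ for all $i$. For integers $l,d\ge 0$ let $Z(\ge l,d,r;V)$ be the union of the sets $Z(W,r;V)$ over all $d$-dimensional subspaces $W\subseteq V$ of isotropy rank at least $l$, and let $$Z(l,d,r;V)=Z(\ge l,d,r;V)\setminus Z(\ge l+1,d,r;V),$$ with the Zariski topology induced from $\operatorname{End}_k(V)^r\cong\mathbb{A}_k^{n^2r}$. Suppose that $Z(l,d,r;V)$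 is not empty. Then $Z(l,d,r;V)$ is irreducible unless $\langle\cdot,\cdot\rangle$ is symmetric, $2d=n$ and $l=d$. In this exceptional case, $Z(l,d,r;V)$ has exactly two irreducible components. More precisely, in that case the group $\operatorname{SO}(V)$ of form-preserving automorphisms of $V$ of determinant $1$ has exactly two orbits on the set of $d$-dimensional totally isotropic subspaces of $V$, and the irreducible components of $Z(d,d,r;V)$ are exactly the two sets $\bigcup_{W\in O}Z(W,r;V)$, where $O$ runs through these two orbits. -/

import Mathlib

namespace InvolutionGenerators

/-- The Zariski topology on the affine space `k^σ`: the closed sets are the common zero loci of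
sets of polynomials. -/
@[reducible] def affineZariski (k : Type*) [Field k] (σ : Type*) : TopologicalSpace (σ → k) :=
  TopologicalSpace.ofClosed
    {Z | ∃ S : Set (MvPolynomial σ k), Z = {x | ∀ p ∈ S, MvPolynomial.eval x p = 0}}
    ⟨{1}, by ext x; simp⟩
    (by
      intro 𝒜 h𝒜
      refine ⟨{p | ∀ x ∈ ⋂₀ 𝒜, MvPolynomial.eval x p = 0}, ?_⟩
      ext x
      simp only [Set.mem_ofPred_eq]
      constructor
      · intro hx p hp
        exact hp x hx
      · intro hx Z hZ
        obtain ⟨S, hS⟩ := h𝒜 hZ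
        rw [hS]
        intro p hp
        refine hx p fun y hy => ?_
        have hyZ := hy Z hZ
        rw [hS] at hyZ
        exact hyZ p hp)
    (by
      rintro _ ⟨S, rfl⟩ _ ⟨T, rfl⟩
      refine ⟨{f | ∃ p ∈ S, ∃ q ∈ T, f = p * q}, ?_⟩
      ext x
      simp only [Set.mem_union, Set.mem_ofPred_eq]
      constructor
      · rintro (h | h) f ⟨p, hp, q, hq, rfl⟩
        · simp [h p hp]
        · simp [h q hq]
      · intro h
        by_contra hcon
        push Not at hcon
        obtain ⟨⟨p, hp, hpx⟩, q, hq, hqx⟩ := hcon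
        have := h _ ⟨p, hp, q, hq, rfl⟩
        rw [map_mul] at this
        exact (mul_ne_zero hpx hqx) this)

/-- The space `End_k(V)^r` of `r`-tuples of endomorphisms of `V = k^n`. -/
def EndTuple (k : Type*) [Field k] (n r : ℕ) : Type _ :=
  Fin r → Module.End k (Fin n → k)

/-- The `r n²` matrix entries of an `r`-tuple of endomorphisms of `k^n`, identifying
`End_k(V)^r` with an affine space. -/
noncomputable def EndTuple.coords {k : Type*} [Field k] {n r : ℕ} (A : EndTuple k n r) :
    Fin r × Fin n × Fin n → k :=
  fun t => LinearMap.toMatrix' (A t.1) t.2.1 t.2.2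

/-- The Zariski topology on `End_k(V)^r`, seen as an affine space of dimension `r n²`. -/
noncomputable instance (k : Type*) [Field k] (n r : ℕ) : TopologicalSpace (EndTuple k n r) :=
  TopologicalSpace.induced EndTuple.coords (affineZariski k (Fin r × Fin n × Fin n))

/-- The bilinear form is skew-symmetric. -/
def IsSkewSymm {k : Type*} [Field k] {n : ℕ} (B : LinearMap.BilinForm k (Fin n → k)) : Prop :=
  ∀ x y, B x y = -B y x

/-- The adjoint involution `ρ(A) = φ⁻¹ ∘ A^* ∘ φ` of `End_k(V)`, where `φ : V → V^*`,
`φ(v)(w) = ⟨v, w⟩`. -/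
noncomputable def rho {k : Type*} [Field k] {n : ℕ} (B : LinearMap.BilinForm k (Fin n → k))
    (hB : B.Nondegenerate) (A : Module.End k (Fin n → k)) : Module.End k (Fin n → k) :=
  (B.toDual hB).symm.toLinearMap ∘ₗ A.dualMap ∘ₗ (B.toDual hB).toLinearMap

/-- The isotropic radical `Iso(W) = W ∩ W^⊥`, where `W^⊥ = {x | ∀ w ∈ W, ⟨w, x⟩ = 0}`. -/
def isoRadical {k : Type*} [Field k] {n : ℕ} (B : LinearMap.BilinForm k (Fin n → k))
    (W : Submodule k (Fin n → k)) : Submodule k (Fin n → k) :=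
  W ⊓ B.orthogonal W

/-- The isotropy rank of a subspace: the dimension of its isotropic radical. -/
noncomputable def isotropyRank {k : Type*} [Field k] {n : ℕ}
    (B : LinearMap.BilinForm k (Fin n → k)) (W : Submodule k (Fin n → k)) : ℕ :=
  Module.finrank k (isoRadical B W)

/-- `Gr(l, d; V)`: the set of `d`-dimensional subspaces of `V` of isotropy rank `l`. -/
def isoGrassmannian {k : Type*} [Field k] {n : ℕ} (B : LinearMap.BilinForm k (Fin n → k))
    (l d : ℕ) : Set (Submodule k (Fin n → k)) :=
  {W | Module.finrank k W = d ∧ isotropyRank B W = l}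

/-- `Z(W, r; V)`: the `r`-tuples for which `W` is a `ρ`-invariant subspace, that is,
`A_i W ⊆ W` and `ρ(A_i) W ⊆ W` for all `i`. -/
def zSubspace {k : Type*} [Field k] {n : ℕ} (r : ℕ) (B : LinearMap.BilinForm k (Fin n → k))
    (hB : B.Nondegenerate) (W : Submodule k (Fin n → k)) : Set (EndTuple k n r) :=
  {A | ∀ i, W.map (A i) ≤ W ∧ W.map (rho B hB (A i)) ≤ W}

/-- `Z(≥ l, d, r; V)`: the union of the `Z(W, r; V)` over all `d`-dimensional subspaces `W` of
isotropy rank at least `l`. -/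
def zGe {k : Type*} [Field k] {n : ℕ} (l d r : ℕ) (B : LinearMap.BilinForm k (Fin n → k))
    (hB : B.Nondegenerate) : Set (EndTuple k n r) :=
  {A | ∃ W : Submodule k (Fin n → k),
    Module.finrank k W = d ∧ l ≤ isotropyRank B W ∧ A ∈ zSubspace r B hB W}

/-- `Z(l, d, r; V) = Z(≥ l, d, r; V) \ Z(≥ l + 1, d, r; V)`. -/
def zLocus {k : Type*} [Field k] {n : ℕ} (l d r : ℕ) (B : LinearMap.BilinForm k (Fin n → k))
    (hB : B.Nondegenerate) : Set (EndTuple k n r) :=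
  zGe l d r B hB \ zGe (l + 1) d r B hB

/-- The orbit of a subspace `W` under `SO(V)`, the group of invertible endomorphisms of `V`
that preserve the bilinear form and have determinant `1`. -/
def soOrbit {k : Type*} [Field k] {n : ℕ} (B : LinearMap.BilinForm k (Fin n → k))
    (W : Submodule k (Fin n → k)) : Set (Submodule k (Fin n → k)) :=
  {U | ∃ g : Module.End k (Fin n → k),
    (∀ x y, B (g x) (g y) = B x y) ∧ LinearMap.det g = 1 ∧ U = W.map g}

/-- The set of `SO(V)`-orbits in `Gr(l, d; V)`. -/
def soOrbits {k : Type*} [Field k] {n : ℕ} (B : LinearMap.BilinForm k (Fin n → k))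
    (l d : ℕ) : Set (Set (Submodule k (Fin n → k))) :=
  soOrbit B '' isoGrassmannian B l d

/-- The irreducible components of a subset `Z` of a topological space, for the subspace
topology, regarded as subsets of the ambient space. -/
def componentsOf {X : Type*} [TopologicalSpace X] (Z : Set X) : Set (Set X) :=
  (fun Y : Set Z => Subtype.val '' Y) '' irreducibleComponents Z

end InvolutionGenerators

namespace InvolutionGenerators

/-! ### Irreducibility from rational curves of isometries. -/

section Topology

variable {k : Type*} [Field k] {n r : ℕ}

/-! The locus `zLocus l d` is the union, over `W` of dimension `d` and isotropy rank exactly `l`, of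
the pieces `zSubspace W` minus `zGe (l + 1) d`. Each `zSubspace W` is a linear space and `zGe (l +
1) d` is closed, so every piece is irreducible or empty. Isometries permute the pieces, by
conjugation. It remains to see when the pieces can be joined inside the locus by connected families
of isometries.

Instead of the algebraic group `SO(V)`, the proof uses `linkedMonoid`, generated by isometries that
a rational curve of determinant-one isometries joins to the identity. Sweeping an irreducible set
`C` along such a curve gives an irreducible set containing both `C` and its translate
(`isPreirreducible_iUnion_image`), so transitivity of `linkedMonoid` on the subspaces `W` makes the
locus irreducible (`isPreirreducible_zLocus`). Symplectic transvections are linked, and so are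
products of two reflections.

Witt's theorem supplies transitivity. In the skew case transvections suffice. In the symmetric case
one obtains a product of reflections, whose parity must be corrected. If `W` or its orthogonal
contains an anisotropic vector, the reflection in it stabilises `W` and corrects the parity;
otherwise `W` equals its orthogonal, which is the exceptional case.

In that case an isometry stabilising `W` has determinant one (`det_eq_one_of_map_eq`), so
reflections exchange exactly two `SO(V)`-orbits. The union of the pieces over each orbit is
irreducible as before. It is also closed: Lagrangians with a common Lagrangian complement lie in one
orbit, so an orbit is cut out by failing to be complementary to certain Lagrangians, a closed
condition. Neither union contains the other, since a tuple of equal nilpotent single Jordan blocks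
has only one invariant subspace of dimension `d`.

Closedness of the loci rests on the properness of Grassmannians, proved here by valuation rings and
the Nullstellensatz (`exists_isSol_of_mem_closure`). -/

lemma isClosed_endTuple_iff (Z : Set (EndTuple k n r)) :
    IsClosed Z ↔ ∃ S : Set (MvPolynomial (Fin r × Fin n × Fin n) k),
      Z = {A | ∀ p ∈ S, MvPolynomial.eval A.coords p = 0} := by
  have key : ∀ C : Set (Fin r × Fin n × Fin n → k),
      @IsClosed _ (affineZariski k (Fin r × Fin n × Fin n)) C ↔
      ∃ S : Set (MvPolynomial (Fin r × Fin n × Fin n) k),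
        C = {x | ∀ p ∈ S, MvPolynomial.eval x p = 0} := by
    intro C
    rw [← @isOpen_compl_iff _ _ (affineZariski k (Fin r × Fin n × Fin n))]
    change Cᶜᶜ ∈ _ ↔ _
    rw [compl_compl]
    rfl
  rw [@isClosed_induced_iff _ _ (affineZariski k (Fin r × Fin n × Fin n))]
  constructor
  · rintro ⟨C, hC, rfl⟩
    obtain ⟨S, rfl⟩ := (key C).1 hC
    exact ⟨S, rfl⟩
  · rintro ⟨S, rfl⟩
    exact ⟨_, (key _).2 ⟨S, rfl⟩, rfl⟩

/-- The functions on the line which are regular where `q` does not vanish. -/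
def regularOn (q : Polynomial k) : Subalgebra k (k → k) where
  carrier := {f | ∃ (p : Polynomial k) (m : ℕ), ∀ t, q.eval t ≠ 0 →
    f t * q.eval t ^ m = p.eval t}
  mul_mem' := by
    rintro f g ⟨p, m, hp⟩ ⟨p', m', hp'⟩
    refine ⟨p * p', m + m', fun t ht => ?_⟩
    rw [Polynomial.eval_mul, ← hp t ht, ← hp' t ht, Pi.mul_apply]
    ring
  add_mem' := by
    rintro f g ⟨p, m, hp⟩ ⟨p', m', hp'⟩
    refine ⟨p * q ^ m' + p' * q ^ m, m + m', fun t ht => ?_⟩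
    rw [Polynomial.eval_add, Polynomial.eval_mul, Polynomial.eval_mul, ← hp t ht, ← hp' t ht,
      Pi.add_apply, Polynomial.eval_pow, Polynomial.eval_pow]
    ring
  algebraMap_mem' c := ⟨Polynomial.C c, 0, fun t _ => by simp⟩

lemma eval_mem_regularOn (q p : Polynomial k) : (fun t => p.eval t) ∈ regularOn q :=
  ⟨p, 0, fun t _ => by simp⟩

lemma const_mem_regularOn (q : Polynomial k) (c : k) : (fun _ => c) ∈ regularOn q :=
  (regularOn q).algebraMap_mem c

lemma finite_zeros_of_mem_regularOn {q : Polynomial k} {f : k → k} (hf : f ∈ regularOn q) {t₀ : k}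
    (ht₀ : q.eval t₀ ≠ 0) (hft : f t₀ ≠ 0) : {t | q.eval t ≠ 0 ∧ f t = 0}.Finite := by
  classical
  obtain ⟨p, m, hp⟩ := hf
  have hp0 : p ≠ 0 := by
    rintro rfl
    have := hp t₀ ht₀
    rw [Polynomial.eval_zero] at this
    exact (mul_ne_zero hft (pow_ne_zero _ ht₀)) this
  refine (p.roots.toFinset.finite_toSet).subset ?_
  rintro t ⟨ht, hft⟩
  have := hp t ht
  rw [hft, zero_mul] at this
  simp [hp0, ← this]

lemma mvEval_mem_regularOn {q : Polynomial k} {σ : Type*} {γ : k → σ → k}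
    (hγ : ∀ s, (fun t => γ t s) ∈ regularOn q) (p : MvPolynomial σ k) :
    (fun t => MvPolynomial.eval (γ t) p) ∈ regularOn q := by
  induction p using MvPolynomial.induction_on with
  | C c => simpa using const_mem_regularOn q c
  | add p p' hp hp' =>
    simp only [map_add]
    exact (regularOn q).add_mem hp hp'
  | mul_X p s hp =>
    simp only [map_mul, MvPolynomial.eval_X]
    exact (regularOn q).mul_mem hp (hγ s)

/-- Some polynomial vanishes off `U` but not at `γ t₀`. Along the curve it becomes a polynomial
divided by a power of `q`, not identically zero, so it has finitely many zeros where `q` does not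
vanish. -/
lemma finite_curve_notMem {q : Polynomial k} {γ : k → EndTuple k n r}
    (hγ : ∀ s, (fun t => (γ t).coords s) ∈ regularOn q) {U : Set (EndTuple k n r)}
    (hU : IsOpen U) {t₀ : k} (ht₀ : q.eval t₀ ≠ 0) (h : γ t₀ ∈ U) :
    {t | q.eval t ≠ 0 ∧ γ t ∉ U}.Finite := by
  obtain ⟨S, hS⟩ := (isClosed_endTuple_iff Uᶜ).1 hU.isClosed_compl
  have h0 : γ t₀ ∉ Uᶜ := fun h' => h' h
  rw [hS] at h0
  simp only [Set.mem_ofPred_eq, not_forall] at h0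
  obtain ⟨p, hpS, hp⟩ := h0
  refine (finite_zeros_of_mem_regularOn (mvEval_mem_regularOn hγ p) ht₀ hp).subset ?_
  rintro t ⟨ht, htU⟩
  refine ⟨ht, ?_⟩
  have : γ t ∈ Uᶜ := htU
  rw [hS] at this
  exact this p hpS

lemma infinite_eval_ne_zero [Infinite k] {q : Polynomial k} (hq : q ≠ 0) :
    {t | q.eval t ≠ 0}.Infinite := by
  classical
  have : ({t | q.eval t = 0} : Set k).Finite :=
    (q.roots.toFinset.finite_toSet).subset fun t ht => by
      have ht' : q.eval t = 0 := ht
      simp [hq, ht']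
  exact this.infinite_compl

/-- Two nonempty open conditions on the union each hold along one curve `t ↦ φ t a` for all but
finitely many `t`. For a common good value `u`, both are nonempty open conditions on `φ u '' C`,
where irreducibility of `C` applies. -/
lemma isPreirreducible_iUnion_image {X T : Type*} [TopologicalSpace X] {C : Set X}
    (hC : IsPreirreducible C) {s : Set T} (hs : s.Infinite) (φ : T → X → X)
    (hcont : ∀ t ∈ s, Continuous (φ t))
    (hcurve : ∀ a ∈ C, ∀ U : Set X, IsOpen U → ∀ t₀ ∈ s, φ t₀ a ∈ U →
      {t | t ∈ s ∧ φ t a ∉ U}.Finite) :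
    IsPreirreducible (⋃ t ∈ s, φ t '' C) := by
  rintro U V hU hV ⟨x, hx, hxU⟩ ⟨y, hy, hyV⟩
  simp only [Set.mem_iUnion, Set.mem_image] at hx hy
  obtain ⟨t, ht, a, ha, rfl⟩ := hx
  obtain ⟨t', ht', a', ha', rfl⟩ := hy
  obtain ⟨u, hu, huf⟩ := hs.exists_notMem_finite
    ((hcurve a ha U hU t ht hxU).union (hcurve a' ha' V hV t' ht' hyV))
  simp only [Set.mem_union, Set.mem_ofPred_eq, not_or, not_and, not_not] at huf
  obtain ⟨b, hb, hbU, hbV⟩ := hC _ _ (hU.preimage (hcont u hu)) (hV.preimage (hcont u hu))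
    ⟨a, ha, huf.1 hu⟩ ⟨a', ha', huf.2 hu⟩
  exact ⟨φ u b, Set.mem_biUnion hu ⟨b, hb, rfl⟩, hbU, hbV⟩

/-- A subset closed under passing to lines through two points is irreducible, and so are its
relatively open subsets. -/
lemma isPreirreducible_of_lines [Infinite k] {Z F : Set (EndTuple k n r)} (hF : IsClosed F)
    (hZ : ∀ A ∈ Z, ∀ A' ∈ Z, ∀ t : k, (fun i => A i + t • (A' i - A i)) ∈ Z) :
    IsPreirreducible (Z \ F) := by
  rintro U V hU hV ⟨A, ⟨hA, hAF⟩, hAU⟩ ⟨A', ⟨hA', hAF'⟩, hAV'⟩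
  let γ : k → EndTuple k n r := fun t i => A i + t • (A' i - A i)
  have hγ : ∀ s, (fun t => (γ t).coords s) ∈ regularOn (1 : Polynomial k) := by
    intro s
    have : (fun t => (γ t).coords s) =
        fun t => (Polynomial.C (A.coords s) + Polynomial.X *
          Polynomial.C (A'.coords s - A.coords s)).eval t := by
      funext t
      simp [γ, EndTuple.coords]
    rw [this]
    exact eval_mem_regularOn _ _
  have h0 : γ 0 = A := by funext i; simp [γ]
  have h1 : γ 1 = A' := by funext i; simp [γ]
  have f0 := finite_curve_notMem hγ (hU.inter hF.isOpen_compl) (t₀ := 0) (by simp)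
    (by rw [h0]; exact ⟨hAU, hAF⟩)
  have f1 := finite_curve_notMem hγ (hV.inter hF.isOpen_compl) (t₀ := 1) (by simp)
    (by rw [h1]; exact ⟨hAV', hAF'⟩)
  obtain ⟨u, -, hu⟩ := (Set.infinite_univ (α := k)).exists_notMem_finite (f0.union f1)
  simp only [Polynomial.eval_one, ne_eq, one_ne_zero, not_false_eq_true, true_and,
    Set.mem_union, Set.mem_ofPred_eq, not_or, not_not] at hu
  exact ⟨γ u, ⟨hZ A hA A' hA' u, hu.1.2⟩, hu.1.1, hu.2.1⟩

/-- Simultaneous conjugation. -/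
def conjTuple (g : (Fin n → k) ≃ₗ[k] (Fin n → k)) (A : EndTuple k n r) : EndTuple k n r :=
  fun i => g.toLinearMap ∘ₗ A i ∘ₗ g.symm.toLinearMap

lemma conjTuple_mul (g h : (Fin n → k) ≃ₗ[k] (Fin n → k)) (A : EndTuple k n r) :
    conjTuple (g * h) A = conjTuple g (conjTuple h A) := by
  funext i
  ext x
  rfl

lemma conjTuple_one (A : EndTuple k n r) : conjTuple 1 A = A := by
  funext i
  ext x
  rfl

lemma coords_conjTuple (g : (Fin n → k) ≃ₗ[k] (Fin n → k)) (A : EndTuple k n r)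
    (s : Fin r × Fin n × Fin n) :
    (conjTuple g A).coords s = ∑ a, ∑ b, LinearMap.toMatrix' g.toLinearMap s.2.1 a *
      (A.coords (s.1, a, b) * LinearMap.toMatrix' g.symm.toLinearMap b s.2.2) := by
  simp only [EndTuple.coords, conjTuple, LinearMap.toMatrix'_comp, Matrix.mul_apply,
    Finset.mul_sum]

lemma continuous_conjTuple (g : (Fin n → k) ≃ₗ[k] (Fin n → k)) :
    Continuous (conjTuple g : EndTuple k n r → EndTuple k n r) := by
  rw [continuous_iff_isClosed]
  intro Z hZ
  obtain ⟨S, rfl⟩ := (isClosed_endTuple_iff Z).1 hZ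
  rw [isClosed_endTuple_iff]
  let P : Fin r × Fin n × Fin n → MvPolynomial (Fin r × Fin n × Fin n) k := fun s =>
    ∑ a, ∑ b, MvPolynomial.C (LinearMap.toMatrix' g.toLinearMap s.2.1 a) *
      (MvPolynomial.X (s.1, a, b) *
        MvPolynomial.C (LinearMap.toMatrix' g.symm.toLinearMap b s.2.2))
  have hP : ∀ (A : EndTuple k n r) p, MvPolynomial.eval (conjTuple g A).coords p =
      MvPolynomial.eval A.coords (MvPolynomial.bind₁ P p) := by
    intro A p
    have h1 : (conjTuple g A).coords = fun s => MvPolynomial.eval A.coords (P s) := by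
      funext s
      simp [P, coords_conjTuple]
    rw [h1, ← MvPolynomial.coe_aeval_eq_eval, ← MvPolynomial.coe_aeval_eq_eval]
    simp only [RingHom.coe_coe, MvPolynomial.aeval_bind₁]
  refine ⟨MvPolynomial.bind₁ P '' S, ?_⟩
  ext A
  simp [hP]

/-- The isometries of determinant one. -/
def IsSpecial (B : LinearMap.BilinForm k (Fin n → k)) (g : (Fin n → k) ≃ₗ[k] (Fin n → k)) : Prop :=
  (∀ x y, B (g x) (g y) = B x y) ∧ LinearMap.det g.toLinearMap = 1

/-- The isometry `g` is the value at `1` of a rational one-parameter family of isometries of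
determinant one whose value at `0` is the identity. -/
def IsLinked (B : LinearMap.BilinForm k (Fin n → k)) (g : (Fin n → k) ≃ₗ[k] (Fin n → k)) : Prop :=
  ∃ (q : Polynomial k) (φ : k → ((Fin n → k) ≃ₗ[k] (Fin n → k))),
    q.eval 0 ≠ 0 ∧ q.eval 1 ≠ 0 ∧ φ 0 = 1 ∧ φ 1 = g ∧
    (∀ t, q.eval t ≠ 0 → IsSpecial B (φ t)) ∧
    ∀ i j, (fun t => LinearMap.toMatrix' (φ t).toLinearMap i j) ∈ regularOn q ∧
      (fun t => LinearMap.toMatrix' (φ t).symm.toLinearMap i j) ∈ regularOn q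

lemma IsLinked.isSpecial {B : LinearMap.BilinForm k (Fin n → k)}
    {g : (Fin n → k) ≃ₗ[k] (Fin n → k)} (hg : IsLinked B g) : IsSpecial B g := by
  obtain ⟨q, φ, -, h1, -, rfl, h, -⟩ := hg
  exact h 1 h1

lemma IsLinked.exists_isPreirreducible [Infinite k] {B : LinearMap.BilinForm k (Fin n → k)}
    {g : (Fin n → k) ≃ₗ[k] (Fin n → k)} (hg : IsLinked B g) {X C : Set (EndTuple k n r)}
    (hX : ∀ h : (Fin n → k) ≃ₗ[k] (Fin n → k), IsSpecial B h → ∀ A ∈ X, conjTuple h A ∈ X)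
    (hC : IsPreirreducible C) (hCX : C ⊆ X) :
    ∃ C', IsPreirreducible C' ∧ C' ⊆ X ∧ C ⊆ C' ∧ ∀ A ∈ C, conjTuple g A ∈ C' := by
  obtain ⟨q, φ, h0, h1, hφ0, hφ1, hiso, hreg⟩ := hg
  have hq : q ≠ 0 := by rintro rfl; simp at h0
  -- The parameter `0` contributes `C` itself and the parameter `1` contributes its conjugate by
  -- `g`.
  refine ⟨⋃ t ∈ {t | q.eval t ≠ 0}, conjTuple (φ t) '' C,
    isPreirreducible_iUnion_image hC (infinite_eval_ne_zero hq) (fun t => conjTuple (φ t))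
      (fun t _ => continuous_conjTuple (φ t)) ?_, ?_, ?_, ?_⟩
  · intro A _ U hU t₀ ht₀ h
    refine finite_curve_notMem (γ := fun t => conjTuple (φ t) A) ?_ hU ht₀ h
    intro s
    have : (fun t => (conjTuple (φ t) A).coords s) =
        ∑ a, ∑ b, (fun t => LinearMap.toMatrix' (φ t).toLinearMap s.2.1 a) *
          ((fun _ => A.coords (s.1, a, b)) *
            fun t => LinearMap.toMatrix' (φ t).symm.toLinearMap b s.2.2) := by
      funext t
      simp [coords_conjTuple, Finset.sum_apply]
    rw [this]
    exact sum_mem fun a _ => sum_mem fun b _ => mul_mem (hreg _ _).1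
      (mul_mem (const_mem_regularOn q _) (hreg _ _).2)
  · simp only [Set.iUnion_subset_iff]
    rintro t ht _ ⟨A, hA, rfl⟩
    exact hX _ (hiso t ht) A (hCX hA)
  · intro A hA
    exact Set.mem_biUnion (show (0 : k) ∈ {t | q.eval t ≠ 0} from h0)
      ⟨A, hA, by rw [hφ0, conjTuple_one]⟩
  · intro A hA
    exact Set.mem_biUnion (show (1 : k) ∈ {t | q.eval t ≠ 0} from h1) ⟨A, hA, by rw [hφ1]⟩

/-- The isometries generated by the linked ones. -/
def linkedMonoid (B : LinearMap.BilinForm k (Fin n → k)) :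
    Submonoid ((Fin n → k) ≃ₗ[k] (Fin n → k)) :=
  Submonoid.closure {g | IsLinked B g}

lemma exists_isPreirreducible_of_mem_linkedMonoid [Infinite k]
    {B : LinearMap.BilinForm k (Fin n → k)} {g : (Fin n → k) ≃ₗ[k] (Fin n → k)}
    (hg : g ∈ linkedMonoid B) {X C : Set (EndTuple k n r)}
    (hX : ∀ h : (Fin n → k) ≃ₗ[k] (Fin n → k), IsSpecial B h → ∀ A ∈ X, conjTuple h A ∈ X)
    (hC : IsPreirreducible C) (hCX : C ⊆ X) :
    ∃ C', IsPreirreducible C' ∧ C' ⊆ X ∧ C ⊆ C' ∧ ∀ A ∈ C, conjTuple g A ∈ C' := by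
  induction hg using Submonoid.closure_induction_left with
  | one => exact ⟨C, hC, hCX, subset_rfl, fun A hA => by rwa [conjTuple_one]⟩
  | mul_left g hg h _ ih =>
    obtain ⟨C', hC', hC'X, hCC', hh⟩ := ih
    obtain ⟨C'', hC'', hC''X, hC'C'', hg'⟩ := hg.exists_isPreirreducible hX hC' hC'X
    refine ⟨C'', hC'', hC''X, hCC'.trans hC'C'', fun A hA => ?_⟩
    rw [conjTuple_mul]
    exact hg' _ (hh A hA)

/-- A union of irreducible pieces which are permuted transitively by linked isometries. -/
lemma isPreirreducible_of_linked_transitive [Infinite k] {ι : Type*}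
    {B : LinearMap.BilinForm k (Fin n → k)} {X : Set (EndTuple k n r)}
    (hX : ∀ h : (Fin n → k) ≃ₗ[k] (Fin n → k), IsSpecial B h → ∀ A ∈ X, conjTuple h A ∈ X)
    (I : Set ι) (Y : ι → Set (EndTuple k n r)) (hYX : ∀ i ∈ I, Y i ⊆ X)
    (hXY : ∀ A ∈ X, ∃ i ∈ I, A ∈ Y i) (hY : ∀ i ∈ I, IsPreirreducible (Y i))
    (htrans : ∀ i ∈ I, ∀ j ∈ I, ∃ g ∈ linkedMonoid B, Y j ⊆ conjTuple g '' Y i) :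
    IsPreirreducible X := by
  rintro U V hU hV ⟨A, hAX, hAU⟩ ⟨A', hAX', hAV'⟩
  obtain ⟨i, hi, hAi⟩ := hXY A hAX
  obtain ⟨j, hj, hAj⟩ := hXY A' hAX'
  obtain ⟨g, hg, hgij⟩ := htrans i hi j hj
  -- `C` is an irreducible subset of `X` containing both the piece `Y i` and its conjugate by `g`,
  -- which covers `Y j`; hence it meets `U` and `V`.
  obtain ⟨C, hC, hCX, hYC, hgC⟩ :=
    exists_isPreirreducible_of_mem_linkedMonoid hg hX (hY i hi) (hYX i hi)
  obtain ⟨A'', hA'', rfl⟩ := hgij hAj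
  obtain ⟨b, hbC, hb⟩ := hC U V hU hV ⟨A, hYC hAi, hAU⟩ ⟨_, hgC _ hA'', hAV'⟩
  exact ⟨b, hCX hbC, hb⟩

end Topology

/-! ### Properness of the Grassmannian by valuation rings. -/

section Closedness

/-- The determinant of `L * M = 1`, expanded multilinearly in the rows, is a combination of the
minors of `M`. The selection `I` need not be injective, which allows a single entry to be changed
freely later on. -/
lemma exists_det_submatrix_ne_zero {K m ι : Type*} [Field K] [Fintype m] [DecidableEq m]
    [Fintype ι] [DecidableEq ι] {M : Matrix m ι K} {L : Matrix ι m K} (hL : L * M = 1) :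
    ∃ I : ι → m, (M.submatrix I id).det ≠ 0 := by
  by_contra! hcon
  have h1 : (L * M).det = 0 := by
    have h2 : L * M = fun i => ∑ a, L i a • M a := by
      ext i j
      simp [Matrix.mul_apply, Finset.sum_apply]
    change Matrix.detRowAlternating (L * M) = 0
    rw [h2]
    change (Matrix.detRowAlternating (R := K) (n := ι)).toMultilinearMap
      (fun i => ∑ a, L i a • M a) = 0
    rw [MultilinearMap.map_sum]
    refine Finset.sum_eq_zero fun I _ => ?_
    rw [MultilinearMap.map_smul_univ]
    have h3 : (Matrix.detRowAlternating (R := K) (n := ι)).toMultilinearMap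
        (fun i => M (I i)) = (M.submatrix I id).det := rfl
    rw [h3, hcon I, smul_zero]
  rw [hL, Matrix.det_one] at h1
  exact one_ne_zero h1

/-- Normalising a matrix with independent columns at a minor of maximal valuation makes it
integral. -/
lemma exists_submatrix_mul_inv_mem {K m ι : Type*} [Field K] [Fintype m] [DecidableEq m]
    [Fintype ι] [DecidableEq ι] (O : ValuationSubring K) {M : Matrix m ι K} {L : Matrix ι m K}
    (hL : L * M = 1) :
    ∃ I : ι → m, (M.submatrix I id).det ≠ 0 ∧
      ∀ i j, (M * (M.submatrix I id)⁻¹) i j ∈ O := by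
  obtain ⟨I₀, hI₀⟩ := exists_det_submatrix_ne_zero hL
  have : Nonempty (ι → m) := ⟨I₀⟩
  obtain ⟨I, hI⟩ := Finite.exists_max fun I : ι → m => O.valuation (M.submatrix I id).det
  have hdet : (M.submatrix I id).det ≠ 0 := by
    intro h
    have := hI I₀
    rw [h, map_zero, le_zero_iff, map_eq_zero] at this
    exact hI₀ this
  refine ⟨I, hdet, fun i j => ?_⟩
  set P := M.submatrix I id with hP
  have hu : IsUnit P.det := isUnit_iff_ne_zero.2 hdet
  have hrow : M i = ∑ a, (M * P⁻¹) i a • P a := by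
    have : M = M * P⁻¹ * P := by rw [Matrix.nonsing_inv_mul_cancel_right _ _ hu]
    conv_lhs => rw [this]
    ext b
    simp [Matrix.mul_apply, Finset.sum_apply]
  -- Cramer's rule: replacing row `j` of the chosen minor by row `i` of `M` multiplies the
  -- determinant by `(M * P⁻¹) i j`. Maximality of the valuation of the minor then bounds this
  -- entry.
  have hupd : (M.submatrix (Function.update I j i) id) = P.updateRow j (M i) := by
    ext a b
    by_cases h : a = j
    · subst h; simp
    · simp [h, hP]
  have hdet' : (P.updateRow j (M i)).det = (M * P⁻¹) i j * P.det := by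
    rw [hrow, Matrix.det_updateRow_sum, smul_eq_mul]
  have hle := hI (Function.update I j i)
  rw [hupd, hdet', map_mul] at hle
  rw [← O.valuation_le_one_iff]
  have hpos : 0 < O.valuation P.det := by
    rw [zero_lt_iff, ne_eq, map_eq_zero]
    exact hdet
  exact le_of_mul_le_mul_right (by rwa [one_mul]) hpos

/-- `M` has independent columns, `D s` preserves the column space of `M`, the columns of `M * N`
span a subspace of the radical of the column space of `M`, and the column space of `M` is not a
complement of those of the `U j`. -/
structure IsSol {R : Type*} [CommRing R] {S J : Type*} {n d e l : ℕ} (ε : Fin n ≃ Fin d ⊕ Fin e)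
    (D : S → Matrix (Fin n) (Fin n) R) (G : Matrix (Fin n) (Fin n) R)
    (U : J → Matrix (Fin n) (Fin e) R) (M : Matrix (Fin n) (Fin d) R)
    (N : Matrix (Fin d) (Fin l) R) (L : Matrix (Fin d) (Fin n) R)
    (L' : Matrix (Fin l) (Fin d) R) : Prop where
  left : L * M = 1
  left' : L' * N = 1
  stable : ∀ s, D s * M = M * (L * (D s * M))
  radical : M.transpose * G * (M * N) = 0
  det : ∀ j, ((Matrix.fromCols M (U j)).submatrix id ε).det = 0

variable {S J : Type*} {n d e l : ℕ} {ε : Fin n ≃ Fin d ⊕ Fin e}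

lemma fromCols_map {R R' : Type*} {m a b : Type*} (M : Matrix m a R) (U : Matrix m b R)
    (f : R → R') : (Matrix.fromCols M U).map f = Matrix.fromCols (M.map f) (U.map f) := by
  ext i (j | j) <;> rfl

/-- All clauses of `IsSol` are polynomial identities, so they can be checked after a jointly
injective family of ring maps. This serves both for products of fields and for subrings; it is also
why the left inverses are part of the data. -/
lemma isSol_of_forall_map {R β : Type*} {R' : β → Type*} [CommRing R] [∀ b, CommRing (R' b)]
    (f : ∀ b, R →+* R' b) (hf : ∀ x y, (∀ b, f b x = f b y) → x = y)
    {D : S → Matrix (Fin n) (Fin n) R} {G : Matrix (Fin n) (Fin n) R}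
    {U : J → Matrix (Fin n) (Fin e) R} {M : Matrix (Fin n) (Fin d) R}
    {N : Matrix (Fin d) (Fin l) R} {L : Matrix (Fin d) (Fin n) R} {L' : Matrix (Fin l) (Fin d) R}
    (h : ∀ b, IsSol ε (fun s => (D s).map (f b)) (G.map (f b)) (fun j => (U j).map (f b))
      (M.map (f b)) (N.map (f b)) (L.map (f b)) (L'.map (f b))) : IsSol ε D G U M N L L' := by
  have inj : ∀ {a c : ℕ} {X Y : Matrix (Fin a) (Fin c) R},
      (∀ b, X.map (f b) = Y.map (f b)) → X = Y := by
    intro a c X Y hXY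
    ext i j
    exact hf _ _ fun b => congrFun (congrFun (hXY b) i) j
  refine ⟨inj fun b => ?_, inj fun b => ?_, fun s => inj fun b => ?_, inj fun b => ?_,
    fun j => hf _ _ fun b => ?_⟩
  · rw [Matrix.map_mul, (h b).left, Matrix.map_one _ (map_zero _) (map_one _)]
  · rw [Matrix.map_mul, (h b).left', Matrix.map_one _ (map_zero _) (map_one _)]
  · simp only [Matrix.map_mul]
    exact (h b).stable s
  · simp only [Matrix.map_mul]
    rw [Matrix.transpose_map, (h b).radical, Matrix.map_zero _ (map_zero _)]
  · rw [RingHom.map_det, RingHom.mapMatrix_apply, ← Matrix.submatrix_map, fromCols_map,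
      (h b).det j, map_zero]

lemma isSol_of_map {R R' : Type*} [CommRing R] [CommRing R'] {f : R →+* R'}
    (hf : Function.Injective f)
    {D : S → Matrix (Fin n) (Fin n) R} {G : Matrix (Fin n) (Fin n) R}
    {U : J → Matrix (Fin n) (Fin e) R} {M : Matrix (Fin n) (Fin d) R}
    {N : Matrix (Fin d) (Fin l) R} {L : Matrix (Fin d) (Fin n) R} {L' : Matrix (Fin l) (Fin d) R}
    (h : IsSol ε (fun s => (D s).map f) (G.map f) (fun j => (U j).map f) (M.map f) (N.map f)
      (L.map f) (L'.map f)) : IsSol ε D G U M N L L' :=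
  isSol_of_forall_map (β := Unit) (fun _ => f) (fun _ _ hxy => hf (hxy ())) fun _ => h

lemma IsSol.map {R R' : Type*} [CommRing R] [CommRing R'] (f : R →+* R')
    {D : S → Matrix (Fin n) (Fin n) R} {G : Matrix (Fin n) (Fin n) R}
    {U : J → Matrix (Fin n) (Fin e) R} {M : Matrix (Fin n) (Fin d) R}
    {N : Matrix (Fin d) (Fin l) R} {L : Matrix (Fin d) (Fin n) R} {L' : Matrix (Fin l) (Fin d) R}
    (h : IsSol ε D G U M N L L') :
    IsSol ε (fun s => (D s).map f) (G.map f) (fun j => (U j).map f) (M.map f) (N.map f) (L.map f)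
      (L'.map f) := by
  have h1 : (1 : Matrix (Fin d) (Fin d) R).map f = 1 := Matrix.map_one _ f.map_zero f.map_one
  have h1' : (1 : Matrix (Fin l) (Fin l) R).map f = 1 := Matrix.map_one _ f.map_zero f.map_one
  have h0 : (0 : Matrix (Fin d) (Fin l) R).map f = 0 := Matrix.map_zero _ f.map_zero
  obtain ⟨a, b, c, x, y⟩ := h
  refine ⟨?_, ?_, fun s => ?_, ?_, fun j => ?_⟩
  · rw [← Matrix.map_mul, a, h1]
  · rw [← Matrix.map_mul, b, h1']
  · rw [← Matrix.map_mul, ← Matrix.map_mul, ← Matrix.map_mul, ← c s]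
  · rw [← Matrix.transpose_map, ← Matrix.map_mul, ← Matrix.map_mul, ← Matrix.map_mul, x, h0]
  · rw [← fromCols_map, Matrix.submatrix_map, ← RingHom.mapMatrix_apply, ← RingHom.map_det,
      y j, f.map_zero]

/-- A solution over the fraction field of a valuation ring has an integral model. -/
lemma IsSol.exists_integral {K : Type*} [Field K] (O : ValuationSubring K)
    {D : S → Matrix (Fin n) (Fin n) K} {G : Matrix (Fin n) (Fin n) K}
    {U : J → Matrix (Fin n) (Fin e) K} {M : Matrix (Fin n) (Fin d) K}
    {N : Matrix (Fin d) (Fin l) K} {L : Matrix (Fin d) (Fin n) K} {L' : Matrix (Fin l) (Fin d) K}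
    (h : IsSol ε D G U M N L L') :
    ∃ (M₁ : Matrix (Fin n) (Fin d) O) (N₁ : Matrix (Fin d) (Fin l) O)
      (L₁ : Matrix (Fin d) (Fin n) O) (L₁' : Matrix (Fin l) (Fin d) O),
      IsSol ε D G U (M₁.map O.subtype) (N₁.map O.subtype) (L₁.map O.subtype)
        (L₁'.map O.subtype) := by
  obtain ⟨I, hI, hIint⟩ := exists_submatrix_mul_inv_mem O h.left
  set P := M.submatrix I id with hP
  have hPu : IsUnit P.det := isUnit_iff_ne_zero.2 hI
  -- In the new basis `M * P⁻¹` the radical vectors `M * N` have coordinates `P * N`, so this is the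
  -- matrix to normalise next.
  have hN : L' * P⁻¹ * (P * N) = 1 := by
    rw [Matrix.mul_assoc, Matrix.nonsing_inv_mul_cancel_left _ _ hPu, h.left']
  obtain ⟨I', hI', hIint'⟩ := exists_submatrix_mul_inv_mem O hN
  set Q := (P * N).submatrix I' id with hQ
  have hQu : IsUnit Q.det := isUnit_iff_ne_zero.2 hI'
  -- The normalised matrices contain an identity block in the selected rows, so row selection is an
  -- integral left inverse.
  let sel : ∀ {a b : ℕ}, (Fin a → Fin b) → Matrix (Fin a) (Fin b) O :=
    fun I => (1 : Matrix _ _ O).submatrix I id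
  have hsel : ∀ {a b c : ℕ} (I : Fin a → Fin b) (X : Matrix (Fin b) (Fin c) K),
      (sel I).map O.subtype * X = X.submatrix I id := by
    intro a b c I X
    have : (sel I).map O.subtype = (1 : Matrix _ _ K).submatrix I id := by
      simp only [sel]
      rw [← Matrix.submatrix_map, Matrix.map_one _ (map_zero _) (map_one _)]
    rw [this]
    ext i j
    simp [Matrix.mul_apply, Matrix.one_apply]
  have hM₁ : (Matrix.of fun i j => (⟨_, hIint i j⟩ : O)).map O.subtype = M * P⁻¹ := by
    ext i j; rfl
  have hN₁ : (Matrix.of fun i j => (⟨_, hIint' i j⟩ : O)).map O.subtype = P * N * Q⁻¹ := by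
    ext i j; rfl
  have hsub : ∀ {a b c : ℕ} (I : Fin a → Fin b) (X : Matrix (Fin b) (Fin c) K)
      (Y : Matrix (Fin c) (Fin c) K), (X * Y).submatrix I id = X.submatrix I id * Y := by
    intro a b c I X Y
    ext i j
    simp [Matrix.mul_apply]
  have e1 : (M * P⁻¹).submatrix I id = 1 := by
    rw [hsub, ← hP, Matrix.mul_nonsing_inv _ hPu]
  have e2 : (P * N * Q⁻¹).submatrix I' id = 1 := by
    rw [hsub, ← hQ, Matrix.mul_nonsing_inv _ hQu]
  refine ⟨Matrix.of fun i j => ⟨_, hIint i j⟩, Matrix.of fun i j => ⟨_, hIint' i j⟩, sel I, sel I',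
    ?_⟩
  rw [hM₁, hN₁]
  refine ⟨by rw [hsel, e1], by rw [hsel, e2], fun s => ?_, ?_, fun j => ?_⟩
  · have key : D s * (M * P⁻¹) = M * P⁻¹ * (P * (L * (D s * M)) * P⁻¹) := by
      rw [← Matrix.mul_assoc (M * P⁻¹), Matrix.mul_assoc M, ← Matrix.mul_assoc P⁻¹,
        Matrix.nonsing_inv_mul _ hPu, Matrix.one_mul, ← h.stable s, Matrix.mul_assoc]
    rw [hsel]
    conv_lhs => rw [key]
    congr 1
    rw [key, hsub, e1, Matrix.one_mul]
  · have : M * P⁻¹ * (P * N * Q⁻¹) = M * N * Q⁻¹ := by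
      rw [Matrix.mul_assoc P, ← Matrix.mul_assoc, Matrix.nonsing_inv_mul_cancel_right _ _ hPu,
        Matrix.mul_assoc]
    rw [this, Matrix.transpose_mul, Matrix.mul_assoc, Matrix.mul_assoc, ← Matrix.mul_assoc G,
      ← Matrix.mul_assoc M.transpose, ← Matrix.mul_assoc M.transpose, h.radical, Matrix.zero_mul, Matrix.mul_zero]
  · have : Matrix.fromCols (M * P⁻¹) (U j) =
        Matrix.fromCols M (U j) *
          (Matrix.fromBlocks P⁻¹ 0 0 1 : Matrix (Fin d ⊕ Fin e) (Fin d ⊕ Fin e) K) := by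
      rw [Matrix.fromCols_mul_fromBlocks]
      simp
    rw [this, ← Matrix.submatrix_mul_equiv _ _ id ε ε, Matrix.det_mul, h.det j, zero_mul]

/-- A solution over an extension of an algebraically closed field gives one over that field. -/
lemma IsSol.descend {k κ : Type*} [Field k] [IsAlgClosed k] [Field κ] [Algebra k κ]
    {D : S → Matrix (Fin n) (Fin n) k} {G : Matrix (Fin n) (Fin n) k}
    {U : J → Matrix (Fin n) (Fin e) k} {M : Matrix (Fin n) (Fin d) κ}
    {N : Matrix (Fin d) (Fin l) κ} {L : Matrix (Fin d) (Fin n) κ} {L' : Matrix (Fin l) (Fin d) κ}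
    (h : IsSol ε (fun s => (D s).map (algebraMap k κ)) (G.map (algebraMap k κ))
      (fun j => (U j).map (algebraMap k κ)) M N L L') :
    ∃ (M : Matrix (Fin n) (Fin d) k) (N : Matrix (Fin d) (Fin l) k)
      (L : Matrix (Fin d) (Fin n) k) (L' : Matrix (Fin l) (Fin d) k), IsSol ε D G U M N L L' := by
  let s : Set κ := Set.range (fun x : Fin n × Fin d => M x.1 x.2) ∪
    Set.range (fun x : Fin d × Fin l => N x.1 x.2) ∪
    Set.range (fun x : Fin d × Fin n => L x.1 x.2) ∪
    Set.range (fun x : Fin l × Fin d => L' x.1 x.2)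
  have hs : s.Finite := (((Set.finite_range _).union (Set.finite_range _)).union
    (Set.finite_range _)).union (Set.finite_range _)
  let A : Subalgebra k κ := Algebra.adjoin k s
  have hsA : s ⊆ A := Algebra.subset_adjoin
  have : Algebra.FiniteType k A := (Subalgebra.fg_iff_finiteType A).1 (by
    have := Subalgebra.fg_adjoin_finset (R := k) hs.toFinset
    rwa [hs.coe_toFinset] at this)
  -- By the Nullstellensatz the residue field of the finitely generated algebra `A` is `k`, which
  -- gives a `k`-point `θ` at which the solution can be specialised.
  obtain ⟨m, hm⟩ := Ideal.exists_maximal A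
  let _ : Field (A ⧸ m) := Ideal.Quotient.field m
  have : Module.Finite k (A ⧸ m) := finite_of_finite_type_of_isJacobsonRing k (A ⧸ m)
  have hbij : Function.Bijective (algebraMap k (A ⧸ m)) :=
    IsAlgClosed.algebraMap_bijective_of_isIntegral
  let θ : A →ₐ[k] k := (AlgEquiv.ofBijective (Algebra.ofId k (A ⧸ m)) hbij).symm.toAlgHom.comp
    (Ideal.Quotient.mkₐ k m)
  let M₁ : Matrix (Fin n) (Fin d) A := Matrix.of fun i j => ⟨M i j, hsA (.inl (.inl (.inl ⟨(i, j), rfl⟩)))⟩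
  let N₁ : Matrix (Fin d) (Fin l) A := Matrix.of fun i j => ⟨N i j, hsA (.inl (.inl (.inr ⟨(i, j), rfl⟩)))⟩
  let L₁ : Matrix (Fin d) (Fin n) A := Matrix.of fun i j => ⟨L i j, hsA (.inl (.inr ⟨(i, j), rfl⟩))⟩
  let L₁' : Matrix (Fin l) (Fin d) A := Matrix.of fun i j => ⟨L' i j, hsA (.inr ⟨(i, j), rfl⟩)⟩
  have h₁ : IsSol ε (fun s => (D s).map (algebraMap k A)) (G.map (algebraMap k A))
      (fun j => (U j).map (algebraMap k A)) M₁ N₁ L₁ L₁' := by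
    exact isSol_of_map (f := A.val.toRingHom) Subtype.val_injective h
  have h₂ := h₁.map θ.toRingHom
  have hθ : ∀ {a b : Type} (X : Matrix a b k), (X.map (algebraMap k A)).map θ.toRingHom = X := by
    intro a b X
    ext i j
    exact θ.commutes _
  simp only [hθ] at h₂
  exact ⟨_, _, _, _, h₂⟩

/-- The map extends to the localisation at `m`, and the image of a local ring in a field is
dominated by a valuation ring. -/
lemma exists_valuationSubring_dominating {A K : Type*} [CommRing A] [Field K] (m : Ideal A)
    [m.IsPrime] (f : A →+* K) (hf : ∀ x ∉ m, f x ≠ 0) :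
    ∃ (O : ValuationSubring K) (F : A →+* O), O.subtype.comp F = f ∧
      ∀ x ∈ m, F x ∈ IsLocalRing.maximalIdeal O := by
  let g : Localization.AtPrime m →+* K :=
    IsLocalization.lift (M := m.primeCompl) (g := f) fun y => isUnit_iff_ne_zero.2 (hf y.1 y.2)
  obtain ⟨O, hO, hloc⟩ := IsLocalRing.exists_factor_valuationRing g
  let g' : Localization.AtPrime m →+* O := g.codRestrict O.toSubring hO
  refine ⟨O, g'.comp (algebraMap A (Localization.AtPrime m)), ?_, fun x hx => ?_⟩
  · ext x
    exact IsLocalization.lift_eq _ x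
  · rw [IsLocalRing.mem_maximalIdeal, mem_nonunits_iff]
    intro hu
    have h1 : IsUnit (algebraMap A (Localization.AtPrime m) x) := hloc.map_nonunit _ hu
    exact (IsLocalization.AtPrime.isUnit_to_map_iff (Localization.AtPrime m) m x).1 h1 hx

/-- Solvability is a closed condition on the parameters. -/
theorem exists_isSol_of_mem_closure {k σ : Type*} [Field k] [IsAlgClosed k]
    (D : S → Matrix (Fin n) (Fin n) (MvPolynomial σ k)) (G : Matrix (Fin n) (Fin n) k)
    (U : J → Matrix (Fin n) (Fin e) k) (E : Set (σ → k))
    (hE : ∀ b ∈ E, ∃ (M : Matrix (Fin n) (Fin d) k) (N : Matrix (Fin d) (Fin l) k)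
      (L : Matrix (Fin d) (Fin n) k) (L' : Matrix (Fin l) (Fin d) k),
      IsSol ε (fun s => (D s).map (MvPolynomial.eval b)) G U M N L L')
    (a : σ → k) (ha : ∀ p : MvPolynomial σ k, (∀ b ∈ E, MvPolynomial.eval b p = 0) →
      MvPolynomial.eval a p = 0) :
    ∃ (M : Matrix (Fin n) (Fin d) k) (N : Matrix (Fin d) (Fin l) k)
      (L : Matrix (Fin d) (Fin n) k) (L' : Matrix (Fin l) (Fin d) k),
      IsSol ε (fun s => (D s).map (MvPolynomial.eval a)) G U M N L L' := by
  choose! M N L L' hsol using hE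
  -- Solutions chosen independently at the points of `E` form a single solution over the product
  -- ring `E → k`, with no algebraicity of the choice required.
  let ev : MvPolynomial σ k →+* (E → k) := RingHom.pi fun b => MvPolynomial.eval b.1
  have hR : IsSol ε (fun s => (D s).map ev) (G.map (ev.comp MvPolynomial.C))
      (fun j => (U j).map (ev.comp MvPolynomial.C))
      (Matrix.of fun i j (b : E) => M b.1 i j) (Matrix.of fun i j (b : E) => N b.1 i j)
      (Matrix.of fun i j (b : E) => L b.1 i j) (Matrix.of fun i j (b : E) => L' b.1 i j) := by
    refine isSol_of_forall_map (fun b : E => Pi.evalRingHom (fun _ => k) b)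
      (fun x y hxy => funext hxy) fun b => ?_
    have h1 : ∀ p, Pi.evalRingHom (fun _ => k) b (ev p) = MvPolynomial.eval b.1 p := fun p => rfl
    have h2 : (Pi.evalRingHom (fun _ => k) b).comp (ev.comp MvPolynomial.C) = RingHom.id k := by
      ext c; simp [ev]
    have h3 : (Pi.evalRingHom (fun _ => k) b).comp ev = MvPolynomial.eval b.1 := rfl
    simp only [Matrix.map_map, ← RingHom.coe_comp, h2, h3]
    simp only [RingHom.coe_id, Matrix.map_id]
    exact hsol b.1 b.2
  let m : Ideal (MvPolynomial σ k) := RingHom.ker (MvPolynomial.eval a)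
  have hm : m.IsPrime := RingHom.ker_isPrime _
  -- As `a` lies in the closure of `E`, a polynomial nonzero at `a` is nonzero somewhere on `E`.
  -- Thus the image of the complement of `m` misses `0`, and some prime `P` avoids it.
  obtain ⟨P, hP, -, hPd⟩ := Ideal.exists_le_prime_disjoint (⊥ : Ideal (E → k))
    (m.primeCompl.map ev) (by
      rw [Set.disjoint_left]
      rintro x hx ⟨p, hp, rfl⟩
      refine hp (ha p fun b hb => ?_)
      have : ev p = 0 := hx
      exact congrFun this ⟨b, hb⟩)
  obtain ⟨K, _, toK, htoK⟩ : ∃ (K : Type _) (_ : Field K) (f : (E → k) →+* K),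
      ∀ x, f x = 0 → x ∈ P :=
    ⟨FractionRing ((E → k) ⧸ P), inferInstance,
      (algebraMap ((E → k) ⧸ P) (FractionRing ((E → k) ⧸ P))).comp (Ideal.Quotient.mk P),
      fun x hx => Ideal.Quotient.eq_zero_iff_mem.1
        ((IsFractionRing.injective ((E → k) ⧸ P) (FractionRing ((E → k) ⧸ P)))
          (by rw [map_zero]; exact hx))⟩
  obtain ⟨O, F, hF, hFm⟩ := exists_valuationSubring_dominating m (toK.comp ev) (by
    intro p hp h0
    exact Set.disjoint_left.1 hPd (htoK _ h0) ⟨p, hp, rfl⟩)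
  let κ := IsLocalRing.ResidueField O
  let ι : k →+* κ := (IsLocalRing.residue O).comp (F.comp MvPolynomial.C)
  let _ : Algebra k κ := ι.toAlgebra
  -- Elements of `m` reduce to zero in the residue field, so the reduced parameters are those of the
  -- point `a`.
  have hres : (IsLocalRing.residue O).comp F = ι.comp (MvPolynomial.eval a) := by
    refine MvPolynomial.ringHom_ext (fun c => by simp [ι]) fun p => ?_
    · have := hFm (MvPolynomial.X p - MvPolynomial.C (a p)) (by simp [m])
      rw [map_sub, ← IsLocalRing.residue_eq_zero_iff, map_sub, sub_eq_zero] at this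
      simpa [ι] using this
  obtain ⟨M₁, N₁, L₁, L₁', h₁⟩ := (hR.map toK).exists_integral O
  have h₂ : IsSol ε (fun s => (D s).map F) (G.map (F.comp MvPolynomial.C))
      (fun j => (U j).map (F.comp MvPolynomial.C)) M₁ N₁ L₁ L₁' := by
    refine isSol_of_map (f := O.subtype) Subtype.val_injective ?_
    simp only [Matrix.map_map, ← RingHom.coe_comp, ← RingHom.comp_assoc, hF] at h₁ ⊢
    exact h₁
  have h₃ := h₂.map (IsLocalRing.residue O)
  simp only [Matrix.map_map, ← RingHom.coe_comp, hres] at h₃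
  refine IsSol.descend (κ := κ) (M := M₁.map (IsLocalRing.residue O))
    (N := N₁.map (IsLocalRing.residue O)) (L := L₁.map (IsLocalRing.residue O))
    (L' := L₁'.map (IsLocalRing.residue O)) ?_
  simp only [Matrix.map_map, ← RingHom.coe_comp]
  exact h₃

end Closedness

/-! ### Matrix description and closedness of the loci. -/

section ClosedLoci

variable {k : Type*} [Field k] {n r : ℕ}

/-- The adjoint involution as a linear map. -/
noncomputable def rhoHom (B : LinearMap.BilinForm k (Fin n → k)) (hB : B.Nondegenerate) :
    Module.End k (Fin n → k) →ₗ[k] Module.End k (Fin n → k) where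
  toFun := rho B hB
  map_add' A A' := by
    refine LinearMap.ext fun x => ?_
    simp [rho, LinearMap.dualMap_apply', LinearMap.comp_add]
  map_smul' c A := by
    refine LinearMap.ext fun x => ?_
    simp [rho, LinearMap.dualMap_apply', LinearMap.comp_smul]

/-- The generic matrix in the slot `i`. -/
noncomputable def genericMatrix (k : Type*) [Field k] {n r : ℕ} (i : Fin r) :
    Matrix (Fin n) (Fin n) (MvPolynomial (Fin r × Fin n × Fin n) k) :=
  Matrix.of fun a b => MvPolynomial.X (i, a, b)

/-- The image of the generic matrix under the adjoint involution. -/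
noncomputable def genericRho (B : LinearMap.BilinForm k (Fin n → k)) (hB : B.Nondegenerate)
    (i : Fin r) : Matrix (Fin n) (Fin n) (MvPolynomial (Fin r × Fin n × Fin n) k) :=
  ∑ a, ∑ b, (MvPolynomial.X (i, a, b) : MvPolynomial (Fin r × Fin n × Fin n) k) •
    (LinearMap.toMatrix' (rho B hB (Matrix.toLin' (Matrix.single a b 1)))).map MvPolynomial.C

lemma genericMatrix_map_eval (A : EndTuple k n r) (i : Fin r) :
    (genericMatrix k i).map (MvPolynomial.eval A.coords) = LinearMap.toMatrix' (A i) := by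
  ext a b
  simp [genericMatrix, EndTuple.coords]

lemma genericRho_map_eval (B : LinearMap.BilinForm k (Fin n → k)) (hB : B.Nondegenerate)
    (A : EndTuple k n r) (i : Fin r) :
    (genericRho B hB i).map (MvPolynomial.eval A.coords) =
      LinearMap.toMatrix' (rho B hB (A i)) := by
  have h1 : A i = ∑ a, ∑ b, A.coords (i, a, b) • Matrix.toLin' (Matrix.single a b (1 : k)) := by
    conv_lhs => rw [← Matrix.toLin'_toMatrix' (A i),
      Matrix.matrix_eq_sum_single (LinearMap.toMatrix' (A i))]
    simp only [map_sum, ← map_smul, Matrix.smul_single, smul_eq_mul, mul_one]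
    rfl
  have h2 : rho B hB (A i) = ∑ a, ∑ b, A.coords (i, a, b) •
      rho B hB (Matrix.toLin' (Matrix.single a b (1 : k))) := by
    change rhoHom B hB (A i) = _
    conv_lhs => rw [h1]
    simp only [map_sum, map_smul]
    rfl
  rw [h2]
  ext a b
  simp [genericRho, Matrix.sum_apply, Matrix.map_apply]

lemma exists_injective_range_eq {W : Submodule k (Fin n → k)} {d : ℕ}
    (hW : Module.finrank k W = d) :
    ∃ (f : (Fin d → k) →ₗ[k] (Fin n → k)) (g : (Fin n → k) →ₗ[k] (Fin d → k)),
      g ∘ₗ f = LinearMap.id ∧ LinearMap.range f = W := by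
  let e : (Fin d → k) ≃ₗ[k] W := LinearEquiv.ofFinrankEq _ _ (by simp [hW])
  obtain ⟨g, hg⟩ := LinearMap.exists_leftInverse_of_injective (W.subtype ∘ₗ e.toLinearMap) (by
    rw [LinearMap.ker_eq_bot]
    exact W.injective_subtype.comp e.injective)
  exact ⟨_, g, hg, by rw [LinearMap.range_comp, LinearEquiv.range, Submodule.map_top,
    Submodule.range_subtype]⟩

lemma map_range_le_iff {d : ℕ} {f : (Fin d → k) →ₗ[k] (Fin n → k)}
    {g : (Fin n → k) →ₗ[k] (Fin d → k)} (hgf : g ∘ₗ f = LinearMap.id)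
    (T : Module.End k (Fin n → k)) :
    (LinearMap.range f).map T ≤ LinearMap.range f ↔
      LinearMap.toMatrix' T * LinearMap.toMatrix' f =
        LinearMap.toMatrix' f * (LinearMap.toMatrix' g *
          (LinearMap.toMatrix' T * LinearMap.toMatrix' f)) := by
  simp only [← LinearMap.toMatrix'_comp]
  rw [LinearMap.toMatrix'.injective.eq_iff]
  constructor
  · intro h
    refine LinearMap.ext fun x => ?_
    obtain ⟨y, hy⟩ := h (Submodule.mem_map_of_mem (LinearMap.mem_range_self f x))
    have := LinearMap.congr_fun hgf y
    simp only [LinearMap.comp_apply, LinearMap.id_apply] at this ⊢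
    rw [← hy, this]
  · rintro h _ ⟨_, ⟨x, rfl⟩, rfl⟩
    exact ⟨_, (LinearMap.congr_fun h x).symm⟩

lemma det_fromCols_eq_zero_iff {d e : ℕ} (ε : Fin n ≃ Fin d ⊕ Fin e)
    {f : (Fin d → k) →ₗ[k] (Fin n → k)} {f' : (Fin e → k) →ₗ[k] (Fin n → k)}
    (hf : Function.Injective f) (hf' : Function.Injective f') :
    ((Matrix.fromCols (LinearMap.toMatrix' f) (LinearMap.toMatrix' f')).submatrix id ε).det = 0 ↔
      ¬ IsCompl (LinearMap.range f) (LinearMap.range f') := by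
  have hn : n = d + e := by simpa using Fintype.card_congr ε
  rw [Submodule.isCompl_iff_disjoint _ _ (by
    rw [LinearMap.finrank_range_of_inj hf, LinearMap.finrank_range_of_inj hf']
    simp [hn]), ← Matrix.exists_mulVec_eq_zero_iff, Submodule.disjoint_def, not_forall]
  have hmul : ∀ v : Fin n → k,
      ((Matrix.fromCols (LinearMap.toMatrix' f) (LinearMap.toMatrix' f')).submatrix id ε).mulVec v =
        f (v ∘ ε.symm ∘ Sum.inl) + f' (v ∘ ε.symm ∘ Sum.inr) := by
    intro v
    rw [Matrix.submatrix_mulVec_equiv, Function.comp_id, Matrix.fromCols_mulVec,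
      LinearMap.toMatrix'_mulVec, LinearMap.toMatrix'_mulVec]
    rfl
  constructor
  · rintro ⟨v, hv, hv0⟩
    rw [hmul, add_eq_zero_iff_eq_neg] at hv0
    refine ⟨f (v ∘ ε.symm ∘ Sum.inl), fun h => hv ?_⟩
    have h1 : f (v ∘ ε.symm ∘ Sum.inl) = 0 :=
      h ⟨_, rfl⟩ ⟨-(v ∘ ε.symm ∘ Sum.inr), by rw [map_neg, hv0]⟩
    have h2 : f' (v ∘ ε.symm ∘ Sum.inr) = 0 := by
      rw [h1, eq_comm, neg_eq_zero] at hv0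
      exact hv0
    have h1' := hf (h1.trans f.map_zero.symm)
    have h2' := hf' (h2.trans f'.map_zero.symm)
    funext i
    rw [← ε.symm_apply_apply i]
    rcases ε i with j | j
    · exact congrFun h1' j
    · exact congrFun h2' j
  · rintro ⟨x, hx⟩
    push Not at hx
    obtain ⟨⟨a, rfl⟩, ⟨b, hb⟩, hx⟩ := hx
    refine ⟨Sum.elim a (-b) ∘ ε, fun h => hx ?_, ?_⟩
    · have : a = 0 := by
        funext j
        have := congrFun h (ε.symm (Sum.inl j))
        simpa using this
      rw [this, map_zero]
    · rw [hmul]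
      have h1 : (Sum.elim a (-b) ∘ ε) ∘ ε.symm ∘ Sum.inl = a := by funext j; simp
      have h2 : (Sum.elim a (-b) ∘ ε) ∘ ε.symm ∘ Sum.inr = -b := by funext j; simp
      rw [h1, h2, map_neg, hb, add_neg_cancel]

lemma le_isotropyRank_iff (B : LinearMap.BilinForm k (Fin n → k)) {d : ℕ} (l : ℕ)
    {f : (Fin d → k) →ₗ[k] (Fin n → k)} (hf : Function.Injective f) :
    l ≤ isotropyRank B (LinearMap.range f) ↔
      ∃ (h : (Fin l → k) →ₗ[k] (Fin d → k)) (h' : (Fin d → k) →ₗ[k] (Fin l → k)),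
        h' ∘ₗ h = LinearMap.id ∧ (LinearMap.toMatrix' f).transpose *
          LinearMap.BilinForm.toMatrix' B * (LinearMap.toMatrix' f * LinearMap.toMatrix' h) = 0 := by
  have hmat : ∀ h : (Fin l → k) →ₗ[k] (Fin d → k), (LinearMap.toMatrix' f).transpose *
      LinearMap.BilinForm.toMatrix' B * (LinearMap.toMatrix' f * LinearMap.toMatrix' h) = 0 ↔
      ∀ x y, B (f x) (f (h y)) = 0 := by
    intro h
    have h1 : ∀ x y, B (f x) (f (h y)) = x ⬝ᵥ ((LinearMap.toMatrix' f).transpose *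
        LinearMap.BilinForm.toMatrix' B *
          (LinearMap.toMatrix' f * LinearMap.toMatrix' h)).mulVec y := by
      intro x y
      have h2 : B (f x) (f (h y)) = f x ⬝ᵥ (LinearMap.BilinForm.toMatrix' B).mulVec (f (h y)) := by
        conv_lhs => rw [← Matrix.toBilin'_toMatrix' B]
        rw [Matrix.toBilin'_apply']
      rw [h2]
      simp only [← Matrix.mulVec_mulVec, LinearMap.toMatrix'_mulVec]
      rw [Matrix.dotProduct_mulVec x, Matrix.vecMul_transpose, LinearMap.toMatrix'_mulVec]
    constructor
    · intro h0 x y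
      rw [h1, h0, Matrix.zero_mulVec, dotProduct_zero]
    · intro h0
      ext i j
      have := h1 (Pi.single i 1) (Pi.single j 1)
      rw [h0] at this
      simpa using this.symm
  obtain ⟨g, hg⟩ := LinearMap.exists_leftInverse_of_injective f (LinearMap.ker_eq_bot.2 hf)
  have hfg : ∀ y ∈ LinearMap.range f, f (g y) = y := by
    rintro _ ⟨x, rfl⟩
    have := LinearMap.congr_fun hg x
    simp only [LinearMap.comp_apply, LinearMap.id_apply] at this
    rw [this]
  simp only [hmat]
  constructor
  · intro hl
    obtain ⟨x, hx⟩ := exists_linearIndependent_of_le_finrank hl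
    let H : (Fin l → k) →ₗ[k] isoRadical B (LinearMap.range f) := Fintype.linearCombination k x
    have hH : Function.Injective H := hx.fintypeLinearCombination_injective
    let h : (Fin l → k) →ₗ[k] (Fin d → k) := g ∘ₗ Submodule.subtype _ ∘ₗ H
    have hfh : ∀ y, f (h y) = H y := fun y => hfg _ (H y).2.1
    obtain ⟨h', hh'⟩ := LinearMap.exists_leftInverse_of_injective h (LinearMap.ker_eq_bot.2 (by
      intro y z hyz
      apply hH
      apply Subtype.ext
      rw [← hfh, ← hfh, hyz]))
    refine ⟨h, h', hh', fun a b => ?_⟩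
    rw [hfh]
    exact (H b).2.2 _ ⟨a, rfl⟩
  · rintro ⟨h, h', hh, h0⟩
    have hh' : Function.Injective h :=
      Function.LeftInverse.injective (g := h') fun x => LinearMap.congr_fun hh x
    have := LinearMap.finrank_le_finrank_of_injective
      (f := (f ∘ₗ h).codRestrict (isoRadical B (LinearMap.range f))
        fun y => ⟨⟨h y, rfl⟩, by rintro _ ⟨x, rfl⟩; exact h0 x y⟩) (by
        intro y z hyz
        exact hh' (hf (congrArg Subtype.val hyz)))
    simpa [isotropyRank] using this

/-- With `𝒰` empty this gives closedness of `zGe`; a nonempty `𝒰` is what separates the two families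
of Lagrangian subspaces. -/
theorem isClosed_setOf_exists_invariant [IsAlgClosed k] (B : LinearMap.BilinForm k (Fin n → k))
    (hB : B.Nondegenerate) (l d : ℕ) (𝒰 : Set (Submodule k (Fin n → k))) :
    IsClosed {A : EndTuple k n r | ∃ W : Submodule k (Fin n → k), Module.finrank k W = d ∧
      l ≤ isotropyRank B W ∧ A ∈ zSubspace r B hB W ∧ ∀ U ∈ 𝒰, ¬ IsCompl W U} := by
  set Z : Set (EndTuple k n r) := {A : EndTuple k n r | ∃ W : Submodule k (Fin n → k),
    Module.finrank k W = d ∧ l ≤ isotropyRank B W ∧ A ∈ zSubspace r B hB W ∧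
      ∀ U ∈ 𝒰, ¬ IsCompl W U} with hZ
  by_cases hd : d ≤ n
  swap
  · have : Z = ∅ := by
      refine Set.eq_empty_of_forall_notMem ?_
      rintro A ⟨W, hW, -⟩
      have := Submodule.finrank_le W
      simp at this
      omega
    rw [this]
    exact isClosed_empty
  obtain ⟨e, rfl⟩ := Nat.exists_eq_add_of_le hd
  let ε : Fin (d + e) ≃ Fin d ⊕ Fin e := finSumFinEquiv.symm
  -- A complement of a `d`-dimensional subspace has dimension `e`, so the other members of `𝒰`
  -- impose no condition.
  let J := {U : Submodule k (Fin (d + e) → k) // U ∈ 𝒰 ∧ Module.finrank k U = e}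
  choose fU gU hgU hfU using fun U : J => exists_injective_range_eq U.2.2
  have hinj : ∀ {a b : ℕ} {f : (Fin a → k) →ₗ[k] (Fin b → k)} {g : (Fin b → k) →ₗ[k] (Fin a → k)},
      g ∘ₗ f = LinearMap.id → Function.Injective f := by
    intro a b f g h
    exact Function.LeftInverse.injective (g := g) fun x => LinearMap.congr_fun h x
  let D : Fin r × Bool → Matrix (Fin (d + e)) (Fin (d + e))
      (MvPolynomial (Fin r × Fin (d + e) × Fin (d + e)) k) :=
    fun s => if s.2 then genericMatrix k s.1 else genericRho B hB s.1
  have key : ∀ A : EndTuple k (d + e) r, A ∈ Z ↔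
      ∃ (M : Matrix (Fin (d + e)) (Fin d) k) (N : Matrix (Fin d) (Fin l) k)
      (L : Matrix (Fin d) (Fin (d + e)) k) (L' : Matrix (Fin l) (Fin d) k),
      IsSol ε (fun s => (D s).map (MvPolynomial.eval A.coords)) (LinearMap.BilinForm.toMatrix' B)
        (fun U : J => LinearMap.toMatrix' (fU U)) M N L L' := by
    intro A
    constructor
    · rintro ⟨W, hW, hl, hA, hU⟩
      obtain ⟨f, g, hgf, rfl⟩ := exists_injective_range_eq hW
      obtain ⟨h, h', hh, hrad⟩ := (le_isotropyRank_iff B l (hinj hgf)).1 hl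
      refine ⟨LinearMap.toMatrix' f, LinearMap.toMatrix' h, LinearMap.toMatrix' g,
        LinearMap.toMatrix' h', ?_, ?_, ?_, hrad, ?_⟩
      · rw [← LinearMap.toMatrix'_comp, hgf, LinearMap.toMatrix'_id]
      · rw [← LinearMap.toMatrix'_comp, hh, LinearMap.toMatrix'_id]
      · rintro ⟨i, _ | _⟩
        · simp only [D, Bool.false_eq_true, if_false, genericRho_map_eval]
          exact (map_range_le_iff hgf _).1 (hA i).2
        · simp only [D, if_true, genericMatrix_map_eval]
          exact (map_range_le_iff hgf _).1 (hA i).1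
      · intro U
        rw [det_fromCols_eq_zero_iff ε (hinj hgf) (hinj (hgU U)), hfU]
        exact hU _ U.2.1
    · rintro ⟨M, N, L, L', hs⟩
      obtain ⟨f, rfl⟩ := LinearMap.toMatrix'.surjective M
      obtain ⟨g, rfl⟩ := LinearMap.toMatrix'.surjective L
      obtain ⟨h, rfl⟩ := LinearMap.toMatrix'.surjective N
      obtain ⟨h', rfl⟩ := LinearMap.toMatrix'.surjective L'
      have hgf : g ∘ₗ f = LinearMap.id := LinearMap.toMatrix'.injective (by
        rw [LinearMap.toMatrix'_comp, hs.left, LinearMap.toMatrix'_id])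
      have hh : h' ∘ₗ h = LinearMap.id := LinearMap.toMatrix'.injective (by
        rw [LinearMap.toMatrix'_comp, hs.left', LinearMap.toMatrix'_id])
      have hfr : Module.finrank k (LinearMap.range f) = d := by
        rw [LinearMap.finrank_range_of_inj (hinj hgf)]; simp
      refine ⟨LinearMap.range f, hfr, (le_isotropyRank_iff B l (hinj hgf)).2 ⟨h, h', hh, hs.radical⟩,
        fun i => ⟨?_, ?_⟩, fun U hU hc => ?_⟩
      · have := hs.stable (i, true)
        simp only [D, if_true, genericMatrix_map_eval] at this
        exact (map_range_le_iff hgf _).2 this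
      · have := hs.stable (i, false)
        simp only [D, Bool.false_eq_true, if_false, genericRho_map_eval] at this
        exact (map_range_le_iff hgf _).2 this
      · have hUe : Module.finrank k U = e := by
          have := Submodule.finrank_add_eq_of_isCompl hc
          rw [hfr] at this
          simpa using this
        have := hs.det ⟨U, hU, hUe⟩
        rw [det_fromCols_eq_zero_iff ε (hinj hgf) (hinj (hgU _)), hfU] at this
        exact this hc
  rw [isClosed_endTuple_iff]
  refine ⟨{p | ∀ A ∈ Z, MvPolynomial.eval A.coords p = 0}, ?_⟩
  refine Set.Subset.antisymm (fun A hA p hp => hp A hA) fun A hA => ?_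
  rw [key]
  refine exists_isSol_of_mem_closure D _ _ (EndTuple.coords '' Z) ?_ A.coords ?_
  · rintro _ ⟨A', hA', rfl⟩
    exact (key A').1 hA'
  · intro p hp
    exact hA p fun A' hA' => hp _ ⟨A', hA', rfl⟩

end ClosedLoci

/-! ### Reflections, transvections and the curves joining them to the identity. -/

section LinkedElements

variable {k : Type*} [Field k] {n : ℕ}

lemma mem_regularOn_congr {q : Polynomial k} {f g : k → k} (hf : f ∈ regularOn q)
    (hfg : ∀ t, q.eval t ≠ 0 → g t = f t) : g ∈ regularOn q := by
  obtain ⟨p, m, hp⟩ := hf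
  exact ⟨p, m, fun t ht => by rw [hfg t ht, hp t ht]⟩

lemma inv_eval_mem_regularOn (q : Polynomial k) : (fun t => (q.eval t)⁻¹) ∈ regularOn q :=
  ⟨1, 1, fun t ht => by simp [ht]⟩

open Classical in
/-- The reflection in the hyperplane orthogonal to an anisotropic vector `v`, and the identity when
`v` is isotropic. -/
noncomputable def orthReflection (B : LinearMap.BilinForm k (Fin n → k)) (v : Fin n → k) :
    (Fin n → k) ≃ₗ[k] (Fin n → k) :=
  if h : B v v ≠ 0 then
    Module.reflection (x := v) (f := (2 / B v v) • B v) (by simp [h])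
  else 1

variable {B : LinearMap.BilinForm k (Fin n → k)}

lemma orthReflection_apply {v : Fin n → k} (h : B v v ≠ 0) (x : Fin n → k) :
    orthReflection B v x = x - (2 / B v v * B v x) • v := by
  rw [orthReflection, dif_pos h, Module.reflection_apply]
  simp

lemma orthReflection_mul_self (v : Fin n → k) : orthReflection B v * orthReflection B v = 1 := by
  by_cases h : B v v ≠ 0
  · rw [orthReflection, dif_pos h]
    exact LinearEquiv.ext fun x => Module.involutive_reflection _ x
  · rw [orthReflection, dif_neg h, one_mul]

lemma orthReflection_symm (v : Fin n → k) : (orthReflection B v).symm = orthReflection B v := by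
  change (orthReflection B v)⁻¹ = _
  exact inv_eq_of_mul_eq_one_right (orthReflection_mul_self v)

lemma orthReflection_isometry (hs : ∀ x y, B x y = B y x) (v x y : Fin n → k) :
    B (orthReflection B v x) (orthReflection B v y) = B x y := by
  by_cases h : B v v ≠ 0
  · rw [orthReflection_apply h, orthReflection_apply h]
    simp only [map_sub, map_smul, LinearMap.sub_apply, LinearMap.smul_apply, smul_eq_mul, hs x v]
    field_simp
    ring
  · rw [orthReflection, dif_neg h]
    rfl

lemma det_orthReflection {v : Fin n → k} (h : B v v ≠ 0) :
    LinearMap.det (orthReflection B v).toLinearMap = -1 := by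
  have : (orthReflection B v).toLinearMap = LinearMap.transvection (-((2 / B v v) • B v)) v := by
    refine LinearMap.ext fun x => ?_
    rw [LinearMap.transvection.apply, LinearEquiv.coe_coe, orthReflection_apply h]
    simp [sub_eq_add_neg]
  rw [this, LinearMap.transvection.det]
  simp [h]
  norm_num

lemma IsSpecial.mul {g h : (Fin n → k) ≃ₗ[k] (Fin n → k)} (hg : IsSpecial B g)
    (hh : IsSpecial B h) : IsSpecial B (g * h) := by
  refine ⟨fun x y => ?_, ?_⟩
  · rw [LinearEquiv.mul_apply, LinearEquiv.mul_apply, hg.1, hh.1]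
  · have : (g * h).toLinearMap = g.toLinearMap * h.toLinearMap := rfl
    rw [this, map_mul, hg.2, hh.2, one_mul]

lemma isSpecial_one : IsSpecial B 1 :=
  ⟨fun _ _ => rfl, LinearMap.det_id⟩

lemma isSpecial_reflection_mul_reflection (hs : ∀ x y, B x y = B y x) {v w : Fin n → k}
    (hv : B v v ≠ 0) (hw : B w w ≠ 0) :
    IsSpecial B (orthReflection B v * orthReflection B w) := by
  refine ⟨fun x y => ?_, ?_⟩
  · rw [LinearEquiv.mul_apply, LinearEquiv.mul_apply, orthReflection_isometry hs,
      orthReflection_isometry hs]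
  · have : (orthReflection B v * orthReflection B w).toLinearMap =
        (orthReflection B v).toLinearMap * (orthReflection B w).toLinearMap := rfl
    rw [this, map_mul, det_orthReflection hv, det_orthReflection hw]
    norm_num

lemma toMatrix'_mul_mem_regularOn {q : Polynomial k} {f g : k → Module.End k (Fin n → k)}
    (hf : ∀ i j, (fun t => LinearMap.toMatrix' (f t) i j) ∈ regularOn q)
    (hg : ∀ i j, (fun t => LinearMap.toMatrix' (g t) i j) ∈ regularOn q) (i j : Fin n) :
    (fun t => LinearMap.toMatrix' (f t ∘ₗ g t) i j) ∈ regularOn q := by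
  have : (fun t => LinearMap.toMatrix' (f t ∘ₗ g t) i j) =
      ∑ a, (fun t => LinearMap.toMatrix' (f t) i a) * fun t => LinearMap.toMatrix' (g t) a j := by
    funext t
    simp only [LinearMap.toMatrix'_comp, Matrix.mul_apply, Finset.sum_apply, Pi.mul_apply]
  rw [this]
  exact sum_mem fun a _ => mul_mem (hf _ _) (hg _ _)

lemma isLinked_reflection_mul_reflection (hs : ∀ x y, B x y = B y x) {v w : Fin n → k}
    (hv : B v v ≠ 0) (hw : B w w ≠ 0) : IsLinked B (orthReflection B v * orthReflection B w) := by
  let u : k → Fin n → k := fun t => v + t • (w - v)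
  -- This is the norm of `u t`, as a polynomial in `t`: the reflection in `u t` is regular exactly
  -- where a denominator `B (u t) (u t)` is allowed.
  let q : Polynomial k := Polynomial.C (B v v) + Polynomial.X * Polynomial.C (2 * B v (w - v)) +
    Polynomial.X ^ 2 * Polynomial.C (B (w - v) (w - v))
  have hq : ∀ t, q.eval t = B (u t) (u t) := by
    intro t
    simp only [q, u, Polynomial.eval_add, Polynomial.eval_mul, Polynomial.eval_C,
      Polynomial.eval_X, Polynomial.eval_pow, map_add, map_smul, LinearMap.add_apply,
      LinearMap.smul_apply, smul_eq_mul, hs (w - v) v]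
    ring
  have hu0 : u 0 = v := by simp [u]
  have hu1 : u 1 = w := by simp [u]
  have hconst : ∀ i j, (fun _ : k => LinearMap.toMatrix' (orthReflection B v).toLinearMap i j) ∈
      regularOn q := fun i j => const_mem_regularOn q _
  have hreg : ∀ i j, (fun t => LinearMap.toMatrix' (orthReflection B (u t)).toLinearMap i j) ∈
      regularOn q := by
    intro i j
    have hcoord : ∀ i, (fun t => u t i) ∈ regularOn q := by
      intro i
      refine mem_regularOn_congr (eval_mem_regularOn q
        (Polynomial.C (v i) + Polynomial.X * Polynomial.C (w i - v i))) fun t _ => ?_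
      simp [u]
    have hB : (fun t => B (u t) (Pi.single j 1)) ∈ regularOn q := by
      refine mem_regularOn_congr (eval_mem_regularOn q
        (Polynomial.C (B v (Pi.single j 1)) + Polynomial.X *
          Polynomial.C (B (w - v) (Pi.single j 1)))) fun t _ => ?_
      simp [u]
    refine mem_regularOn_congr (sub_mem (const_mem_regularOn q ((Pi.single j 1 : Fin n → k) i))
      (mul_mem (mul_mem (mul_mem (const_mem_regularOn q 2) (inv_eval_mem_regularOn q)) hB)
        (hcoord i))) fun t ht => ?_
    rw [LinearMap.toMatrix'_apply, LinearEquiv.coe_coe,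
      orthReflection_apply (by rw [← hq]; exact ht)]
    simp [hq, div_eq_mul_inv, Pi.single_apply]
  -- The constant left factor makes the curve start at a squared reflection, that is, at the
  -- identity, and keeps the determinant equal to one.
  refine ⟨q, fun t => orthReflection B v * orthReflection B (u t), ?_, ?_, ?_, ?_, ?_, ?_⟩
  · rwa [hq, hu0]
  · rwa [hq, hu1]
  · simp only [hu0, orthReflection_mul_self]
  · simp only [hu1]
  · intro t ht
    exact isSpecial_reflection_mul_reflection hs hv (by rwa [← hq])
  · intro i j
    refine ⟨toMatrix'_mul_mem_regularOn hconst hreg i j, ?_⟩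
    have : ∀ t, (orthReflection B v * orthReflection B (u t)).symm.toLinearMap =
        (orthReflection B (u t)).toLinearMap ∘ₗ (orthReflection B v).toLinearMap := by
      intro t
      refine LinearMap.ext fun x => ?_
      change (orthReflection B (u t)).symm ((orthReflection B v).symm x) = _
      rw [orthReflection_symm, orthReflection_symm]
      rfl
    simp only [this]
    exact toMatrix'_mul_mem_regularOn hreg hconst i j

/-- The transvection `x ↦ x + c ⟨a, x⟩ a`. -/
noncomputable def formTransvection (B : LinearMap.BilinForm k (Fin n → k))
    (ha : ∀ x, B x x = 0) (a : Fin n → k) (c : k) : (Fin n → k) ≃ₗ[k] (Fin n → k) :=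
  LinearEquiv.transvection (f := c • B a) (v := a) (by simp [ha])

lemma formTransvection_apply (ha : ∀ x, B x x = 0) (a : Fin n → k) (c : k) (x : Fin n → k) :
    formTransvection B ha a c x = x + (c * B a x) • a := by
  simp [formTransvection, LinearMap.transvection.apply]

lemma formTransvection_symm (ha : ∀ x, B x x = 0) (a : Fin n → k) (c : k) :
    (formTransvection B ha a c).symm = formTransvection B ha a (-c) := by
  refine LinearEquiv.ext fun x => ?_
  rw [LinearEquiv.symm_apply_eq]
  simp [formTransvection_apply, ha]

lemma isLinked_formTransvection (hs : IsSkewSymm B) (ha : ∀ x, B x x = 0) (a : Fin n → k) (c : k) :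
    IsLinked B (formTransvection B ha a c) := by
  have hreg : ∀ e : k, ∀ i j, (fun t => LinearMap.toMatrix'
      (formTransvection B ha a (t * e)).toLinearMap i j) ∈ regularOn (1 : Polynomial k) := by
    intro e i j
    refine mem_regularOn_congr (eval_mem_regularOn 1
      (Polynomial.C ((Pi.single j 1 : Fin n → k) i) + Polynomial.X *
        Polynomial.C (e * B a (Pi.single j 1) * a i))) fun t _ => ?_
    rw [LinearMap.toMatrix'_apply, LinearEquiv.coe_coe, formTransvection_apply]
    simp [mul_assoc]
  refine ⟨1, fun t => formTransvection B ha a (t * c), by simp, by simp, ?_, ?_, ?_, ?_⟩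
  · refine LinearEquiv.ext fun x => ?_
    rw [formTransvection_apply]
    simp
  · simp
  · intro t _
    refine ⟨fun x y => ?_, ?_⟩
    · simp only [formTransvection_apply, map_add, map_smul, LinearMap.add_apply,
        LinearMap.smul_apply, smul_eq_mul, ha]
      rw [hs x a]
      ring
    · change LinearMap.det (LinearMap.transvection _ _) = 1
      rw [LinearMap.transvection.det]
      simp [ha]
  · intro i j
    refine ⟨hreg c i j, ?_⟩
    simp only [formTransvection_symm, ← mul_neg]
    exact hreg (-c) i j

/-- The isometries which are products of reflections. -/
noncomputable def reflectionMonoid (B : LinearMap.BilinForm k (Fin n → k)) :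
    Submonoid ((Fin n → k) ≃ₗ[k] (Fin n → k)) :=
  Submonoid.closure {g | ∃ v, B v v ≠ 0 ∧ g = orthReflection B v}

lemma orthReflection_mem {v : Fin n → k} (hv : B v v ≠ 0) :
    orthReflection B v ∈ reflectionMonoid B :=
  Submonoid.subset_closure ⟨v, hv, rfl⟩

/-- Parity of the number of reflections: pairs of consecutive reflections are linked, and an odd
product becomes even after one more reflection, in any anisotropic vector. -/
lemma mem_linkedMonoid_or_mul_reflection_mem (hs : ∀ x y, B x y = B y x)
    {g : (Fin n → k) ≃ₗ[k] (Fin n → k)} (hg : g ∈ reflectionMonoid B) :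
    g ∈ linkedMonoid B ∨ ∀ v, B v v ≠ 0 → g * orthReflection B v ∈ linkedMonoid B := by
  induction hg using Submonoid.closure_induction_right with
  | one => exact .inl (one_mem _)
  | mul_right g _ y hy ih =>
    obtain ⟨w, hw, rfl⟩ := hy
    rcases ih with ih | ih
    · refine .inr fun v hv => ?_
      rw [mul_assoc]
      exact mul_mem ih (Submonoid.subset_closure (isLinked_reflection_mul_reflection hs hw hv))
    · exact .inl (ih w hw)

lemma isSpecial_of_mem_linkedMonoid {g : (Fin n → k) ≃ₗ[k] (Fin n → k)}
    (hg : g ∈ linkedMonoid B) : IsSpecial B g := by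
  induction hg using Submonoid.closure_induction with
  | mem g hg => exact hg.isSpecial
  | one => exact isSpecial_one
  | mul g h _ _ hg hh => exact hg.mul hh

lemma isometry_of_mem_reflectionMonoid (hs : ∀ x y, B x y = B y x)
    {g : (Fin n → k) ≃ₗ[k] (Fin n → k)} (hg : g ∈ reflectionMonoid B) (x y : Fin n → k) :
    B (g x) (g y) = B x y := by
  induction hg using Submonoid.closure_induction generalizing x y with
  | mem g hg =>
    obtain ⟨v, -, rfl⟩ := hg
    exact orthReflection_isometry hs v x y
  | one => rfl
  | mul g h _ _ hg hh => rw [LinearEquiv.mul_apply, LinearEquiv.mul_apply, hg, hh]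

end LinkedElements

/-! ### Witt extension, one vector at a time. -/

section Witt

variable {k : Type*} [Field k] {n : ℕ} {B : LinearMap.BilinForm k (Fin n → k)}

lemma exists_mem_orthogonal_ne_zero (hB : B.Nondegenerate) (hr : B.IsRefl)
    {F : Submodule k (Fin n → k)} {u : Fin n → k} (hu : u ∉ F) :
    ∃ x ∈ B.orthogonal F, B u x ≠ 0 := by
  by_contra! hcon
  apply hu
  rw [← LinearMap.BilinForm.orthogonal_orthogonal hB hr F]
  intro x hx
  exact hr _ _ (hcon x hx)

/-- Each condition alone can be met because `F` is its own double orthogonal; if neither witness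
meets both, their sum does. -/
lemma exists_mem_orthogonal_ne_zero₂ (hB : B.Nondegenerate) (hr : B.IsRefl)
    {F : Submodule k (Fin n → k)} {u u' : Fin n → k} (hu : u ∉ F) (hu' : u' ∉ F) :
    ∃ x ∈ B.orthogonal F, B u x ≠ 0 ∧ B u' x ≠ 0 := by
  obtain ⟨x, hx, hux⟩ := exists_mem_orthogonal_ne_zero hB hr hu
  obtain ⟨y, hy, huy⟩ := exists_mem_orthogonal_ne_zero hB hr hu'
  by_cases h1 : B u' x = 0
  · by_cases h2 : B u y = 0
    · exact ⟨x + y, add_mem hx hy, by simpa [h2] using hux, by simpa [h1] using huy⟩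
    · exact ⟨y, hy, h2, huy⟩
  · exact ⟨x, hx, hux, h1⟩

lemma orthReflection_map_of_norm_eq (hs : ∀ x y, B x y = B y x) {u u' : Fin n → k}
    (h : B u u = B u' u') (hne : B (u - u') (u - u') ≠ 0) :
    orthReflection B (u - u') u = u' := by
  have h1 : 2 * B (u - u') u = B (u - u') (u - u') := by
    simp only [map_sub, LinearMap.sub_apply, ← h, hs u u']
    ring
  rw [orthReflection_apply hne, div_mul_eq_mul_div, h1, div_self hne, one_smul, sub_sub_cancel]

lemma orthReflection_fix {u x : Fin n → k} (h : B u x = 0) : orthReflection B u x = x := by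
  by_cases hu : B u u ≠ 0
  · rw [orthReflection_apply hu, h]
    simp
  · rw [orthReflection, dif_neg hu]
    rfl

/-- Reflections in vectors of the orthogonal of `F` fix `F`. If `u - u'` is anisotropic, its
reflection sends `u` to `u'`. Otherwise, for `u` anisotropic, `u + u'` has norm `4 * B u u`, and one
reflects `u` to `-u'` and then in `u'`. If `u` is isotropic, one passes through an isotropic `z`
orthogonal to neither `u` nor `u'`. -/
lemma exists_reflections_map (h2 : (2 : k) ≠ 0) (hB : B.Nondegenerate)
    (hs : ∀ x y, B x y = B y x) {F : Submodule k (Fin n → k)} {u u' : Fin n → k} (hu : u ∉ F)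
    (hu' : u' ∉ F) (huF : u ∈ B.orthogonal F) (huF' : u' ∈ B.orthogonal F)
    (h : B u u = B u' u') :
    ∃ g ∈ reflectionMonoid B, (∀ x ∈ F, g x = x) ∧ g u = u' := by
  have hr : B.IsRefl := fun x y hxy => by rw [hs, hxy]
  have hfix : ∀ z ∈ B.orthogonal F, ∀ x ∈ F, orthReflection B z x = x := fun z hz x hx =>
    orthReflection_fix (hr _ _ (hz x hx))
  by_cases h1 : B (u - u') (u - u') = 0
  swap
  · exact ⟨_, orthReflection_mem h1, hfix _ (sub_mem huF huF'),
      orthReflection_map_of_norm_eq hs h h1⟩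
  by_cases h3 : B u u = 0
  · have h4 : B u u' = 0 := by
      simp only [map_sub, LinearMap.sub_apply, ← h, hs u' u, h3] at h1
      have : 2 * B u u' = 0 := by linear_combination -h1
      simpa [h2] using this
    obtain ⟨x, hx, hux, hux'⟩ := exists_mem_orthogonal_ne_zero₂ hB hr hu hu'
    -- The multiple of the isotropic vector `u` is chosen to make `z` isotropic; it leaves the
    -- pairings with `u` and `u'` unchanged.
    set z := x - (B x x / (2 * B u x)) • u with hz
    have hzF : z ∈ B.orthogonal F := sub_mem hx (Submodule.smul_mem _ _ huF)
    have hzz : B z z = 0 := by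
      simp only [hz, map_sub, map_smul, LinearMap.sub_apply, LinearMap.smul_apply, smul_eq_mul, h3,
        hs x u]
      field_simp
      ring
    have huz : B u z = B u x := by simp [hz, h3]
    have huz' : B u' z = B u' x := by simp [hz, hs u' u, h4]
    have e1 : B (u - z) (u - z) ≠ 0 := by
      have : B (u - z) (u - z) = -(2 * B u x) := by
        simp only [map_sub, LinearMap.sub_apply, h3, hzz, hs z u, huz]
        ring
      rw [this]
      exact neg_ne_zero.2 (mul_ne_zero h2 hux)
    have e2 : B (z - u') (z - u') ≠ 0 := by
      have : B (z - u') (z - u') = -(2 * B u' x) := by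
        simp only [map_sub, LinearMap.sub_apply, ← h, h3, hzz, hs z u', huz']
        ring
      rw [this]
      exact neg_ne_zero.2 (mul_ne_zero h2 hux')
    refine ⟨orthReflection B (z - u') * orthReflection B (u - z),
      mul_mem (orthReflection_mem e2) (orthReflection_mem e1), fun x hx => ?_, ?_⟩
    · rw [LinearEquiv.mul_apply, hfix _ (sub_mem huF hzF) x hx, hfix _ (sub_mem hzF huF') x hx]
    · rw [LinearEquiv.mul_apply, orthReflection_map_of_norm_eq hs (by rw [h3, hzz]) e1,
        orthReflection_map_of_norm_eq hs (by rw [hzz, ← h, h3]) e2]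
  · have h3' : B u' u' ≠ 0 := by rwa [← h]
    have e1 : B (u - -u') (u - -u') ≠ 0 := by
      have : B (u - -u') (u - -u') = 4 * B u u := by
        simp only [map_sub, LinearMap.sub_apply, map_neg, LinearMap.neg_apply, ← h, hs u' u]
          at h1 ⊢
        linear_combination -h1
      rw [this]
      refine mul_ne_zero ?_ h3
      have : (4 : k) = 2 * 2 := by norm_num
      rw [this]
      exact mul_ne_zero h2 h2
    refine ⟨orthReflection B u' * orthReflection B (u - -u'),
      mul_mem (orthReflection_mem h3') (orthReflection_mem e1), fun x hx => ?_, ?_⟩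
    · rw [LinearEquiv.mul_apply, hfix _ (sub_mem huF (neg_mem huF')) x hx, hfix _ huF' x hx]
    · rw [LinearEquiv.mul_apply, orthReflection_map_of_norm_eq hs (by simp [h]) e1, map_neg,
        orthReflection_apply h3']
      field_simp
      module

/-- When `B u u'` is nonzero, a suitably scaled transvection along `u' - u` sends `u` to `u'`.
Otherwise one goes through `u + x`, with `x` orthogonal to `F` but to neither `u` nor `u'`. Only
differences must be orthogonal to `F`. -/
lemma exists_transvections_map (hB : B.Nondegenerate) (hs : IsSkewSymm B) (ha : ∀ x, B x x = 0)
    {F : Submodule k (Fin n → k)} {u u' : Fin n → k} (hu : u ∉ F)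
    (hu' : u' ∉ F) (huF : u - u' ∈ B.orthogonal F) :
    ∃ g ∈ linkedMonoid B, (∀ x ∈ F, g x = x) ∧ g u = u' := by
  have hr : B.IsRefl := fun x y hxy => by rw [hs, hxy, neg_zero]
  have step : ∀ u u' : Fin n → k, u' - u ∈ B.orthogonal F → B u u' ≠ 0 →
      ∃ g ∈ linkedMonoid B, (∀ x ∈ F, g x = x) ∧ g u = u' := by
    intro u u' hF hne
    refine ⟨formTransvection B ha (u' - u) (B u' u)⁻¹,
      Submonoid.subset_closure (isLinked_formTransvection hs ha _ _), fun x hx => ?_, ?_⟩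
    · rw [formTransvection_apply, hr _ _ (hF x hx)]
      simp
    · have : B u' u ≠ 0 := by rw [hs]; exact neg_ne_zero.2 hne
      rw [formTransvection_apply]
      simp [ha, this]
  obtain ⟨x, hx, hux, hux'⟩ := exists_mem_orthogonal_ne_zero₂ hB hr hu hu'
  by_cases h1 : B u u' = 0
  · obtain ⟨g, hg, hgF, hgu⟩ := step u (u + x) (by simpa using hx) (by simpa [ha] using hux)
    obtain ⟨g', hg', hgF', hgu'⟩ := step (u + x) u'
      (by rw [← neg_mem_iff]; convert add_mem huF hx using 1; abel)
      (by rw [map_add, LinearMap.add_apply, h1, zero_add, hs]; exact neg_ne_zero.2 hux')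
    exact ⟨g' * g, mul_mem hg' hg, fun x hx => by rw [LinearEquiv.mul_apply, hgF x hx, hgF' x hx],
      by rw [LinearEquiv.mul_apply, hgu, hgu']⟩
  · exact step u u' (by rw [← neg_mem_iff]; simpa using huF) h1

/-- Witt extension by induction on the number of vectors, from a one-vector extension property. -/
lemma exists_mem_submonoid_map {ι : Type*} [Finite ι]
    (M : Submonoid ((Fin n → k) ≃ₗ[k] (Fin n → k))) {w w' : ι → Fin n → k}
    (hw : LinearIndependent k w) (hw' : LinearIndependent k w')
    (step : ∀ (s : Set ι) (a : ι), a ∉ s → ∀ h ∈ M, (∀ i ∈ s, h (w i) = w' i) →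
      h (w a) ∉ Submodule.span k (w' '' s) → w' a ∉ Submodule.span k (w' '' s) →
      ∃ g ∈ M, (∀ x ∈ Submodule.span k (w' '' s), g x = x) ∧ g (h (w a)) = w' a) :
    ∃ g ∈ M, ∀ i, g (w i) = w' i := by
  classical
  have := Fintype.ofFinite ι
  suffices ∀ s : Finset ι, ∃ g ∈ M, ∀ i ∈ s, g (w i) = w' i by
    obtain ⟨g, hg, h⟩ := this Finset.univ
    exact ⟨g, hg, fun i => h i (Finset.mem_univ i)⟩
  intro s
  induction s using Finset.induction_on with
  | empty => exact ⟨1, one_mem _, by simp⟩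
  | insert a s has ih =>
    obtain ⟨h, hh, hs⟩ := ih
    have hw1 : LinearIndependent k (h ∘ w) := hw.map' h.toLinearMap h.ker
    have hne : h (w a) ∉ Submodule.span k (w' '' (s : Set ι)) := by
      have h1 := hw1.notMem_span_image (s := (s : Set ι)) (x := a) (by simpa using has)
      have h2 : (h ∘ w) '' (s : Set ι) = w' '' (s : Set ι) :=
        Set.image_congr fun i hi => hs i (by simpa using hi)
      rwa [h2] at h1
    have hne' := hw'.notMem_span_image (s := (s : Set ι)) (x := a) (by simpa using has)
    obtain ⟨g, hg, hgF, hga⟩ := step s a (by simpa using has) h hh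
      (fun i hi => hs i (by simpa using hi)) hne hne'
    refine ⟨g * h, mul_mem hg hh, fun i hi => ?_⟩
    rw [LinearEquiv.mul_apply]
    rcases Finset.mem_insert.1 hi with rfl | hi
    · exact hga
    · rw [hs i hi, hgF _ (Submodule.subset_span ⟨i, by simpa using hi, rfl⟩)]

lemma mem_orthogonal_span_image {ι : Type*} {w' : ι → Fin n → k} {s : Set ι} {x : Fin n → k}
    (h : ∀ i ∈ s, B (w' i) x = 0) : x ∈ B.orthogonal (Submodule.span k (w' '' s)) := by
  intro y hy
  induction hy using Submodule.span_induction with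
  | mem y hy => obtain ⟨i, hi, rfl⟩ := hy; exact h i hi
  | zero => change B 0 x = 0; simp
  | add y z _ _ hy hz => change B (y + z) x = 0; rw [map_add, LinearMap.add_apply, hy, hz, add_zero]
  | smul c y _ hy => change B (c • y) x = 0; rw [map_smul, LinearMap.smul_apply, hy, smul_zero]

/-- The one-vector step wants both vectors orthogonal to those already matched, which is why the
family is assumed orthogonal; the Gram matrices then only need to agree on the diagonal. -/
lemma exists_reflections_map_family (h2 : (2 : k) ≠ 0) (hB : B.Nondegenerate)
    (hs : ∀ x y, B x y = B y x) {ι : Type*} [Finite ι] {w w' : ι → Fin n → k}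
    (hw : LinearIndependent k w) (hw' : LinearIndependent k w')
    (h : ∀ i j, B (w i) (w j) = B (w' i) (w' j)) (ho : ∀ i j, i ≠ j → B (w i) (w j) = 0) :
    ∃ g ∈ reflectionMonoid B, ∀ i, g (w i) = w' i := by
  refine exists_mem_submonoid_map _ hw hw' fun s a ha g hg hgs h1 h2' => ?_
  refine exists_reflections_map h2 hB hs h1 h2' (mem_orthogonal_span_image fun i hi => ?_)
    (mem_orthogonal_span_image fun i hi => ?_) ?_
  · rw [← hgs i hi, isometry_of_mem_reflectionMonoid hs hg]
    exact ho i a (by rintro rfl; exact ha hi)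
  · rw [← h]
    exact ho i a (by rintro rfl; exact ha hi)
  · rw [isometry_of_mem_reflectionMonoid hs hg, h]

lemma exists_transvections_map_family (hB : B.Nondegenerate) (hs : IsSkewSymm B)
    (ha : ∀ x, B x x = 0) {ι : Type*} [Finite ι] {w w' : ι → Fin n → k}
    (hw : LinearIndependent k w) (hw' : LinearIndependent k w')
    (h : ∀ i j, B (w i) (w j) = B (w' i) (w' j)) :
    ∃ g ∈ linkedMonoid B, ∀ i, g (w i) = w' i := by
  refine exists_mem_submonoid_map _ hw hw' fun s a _ g hg hgs h1 h2 => ?_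
  refine exists_transvections_map hB hs ha h1 h2 (mem_orthogonal_span_image fun i hi => ?_)
  rw [map_sub, ← h, ← hgs i hi, (isSpecial_of_mem_linkedMonoid hg).1, sub_self]

end Witt

/-! ### Normal forms of subspaces and Witt's theorem. -/

section NormalForms

variable {k : Type*} [Field k] {n : ℕ} {B : LinearMap.BilinForm k (Fin n → k)}

lemma linearIndependent_of_gram {ι : Type*} [Fintype ι] [DecidableEq ι] {w : ι → Fin n → k}
    {J : Matrix ι ι k} (hJ : J.det ≠ 0) (h : ∀ i j, B (w i) (w j) = J i j) :
    LinearIndependent k w := by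
  rw [Fintype.linearIndependent_iff]
  intro c hc
  have h1 : Matrix.vecMul c J = 0 := by
    funext j
    have := congrArg (fun x => B x (w j)) hc
    simpa [map_sum, LinearMap.sum_apply, h, Matrix.vecMul, dotProduct] using this
  exact fun i => congrFun (Matrix.eq_zero_of_vecMul_eq_zero hJ h1) i

/-- Any complement `N` of the radical in `W` is nondegenerate: a vector of `N` orthogonal to `N` is
orthogonal to the radical as well, hence to `W`, and so lies in the radical. -/
lemma exists_nondegenerate_complement (hr : B.IsRefl) (W : Submodule k (Fin n → k)) :
    ∃ N : Submodule k (Fin n → k), N ≤ W ∧ Disjoint (isoRadical B W) N ∧ isoRadical B W ⊔ N = W ∧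
      isotropyRank B W + Module.finrank k N = Module.finrank k W ∧
      ∀ x ∈ N, (∀ y ∈ N, B x y = 0) → x = 0 := by
  obtain ⟨C, hC⟩ := Submodule.exists_isCompl (isoRadical B W)
  have hRW : isoRadical B W ≤ W := inf_le_left
  have hsup : isoRadical B W ⊔ C ⊓ W = W := by
    rw [← sup_inf_assoc_of_le _ hRW, hC.sup_eq_top, top_inf_eq]
  have hdis : Disjoint (isoRadical B W) (C ⊓ W) := hC.disjoint.mono_right inf_le_left
  refine ⟨C ⊓ W, inf_le_right, hdis, hsup, ?_, fun x hx hxy => ?_⟩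
  · have := Submodule.finrank_sup_add_finrank_inf_eq (isoRadical B W) (C ⊓ W)
    rw [hsup, hdis.eq_bot, finrank_bot, add_zero] at this
    exact this.symm
  · refine (Submodule.disjoint_def.1 hdis) x ⟨hx.2, fun w hw => ?_⟩ hx
    change B w x = 0
    rw [← hsup] at hw
    obtain ⟨r, hrr, y, hy, rfl⟩ := Submodule.mem_sup.1 hw
    rw [map_add, LinearMap.add_apply, hr _ _ (hxy y hy), hr _ _ (hrr.2 x hx.2), add_zero]

/-- The radical together with a normal form for nondegenerate subspaces gives a normal form. -/
lemma exists_adapted_family (hr : B.IsRefl) {l m : ℕ} {ι : Type*} [Fintype ι] [DecidableEq ι]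
    {J : Matrix ι ι k} (hJ : J.det ≠ 0)
    (hnf : ∀ N : Submodule k (Fin n → k), Module.finrank k N = m →
      (∀ x ∈ N, (∀ y ∈ N, B x y = 0) → x = 0) →
      Fintype.card ι = m ∧ ∃ w : ι → Fin n → k, (∀ i, w i ∈ N) ∧ ∀ i j, B (w i) (w j) = J i j)
    {W : Submodule k (Fin n → k)} (hl : isotropyRank B W = l) (hW : Module.finrank k W = l + m) :
    ∃ w : Fin l ⊕ ι → Fin n → k, LinearIndependent k w ∧ Submodule.span k (Set.range w) = W ∧
      ∀ i j, B (w i) (w j) =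
        (Matrix.fromBlocks 0 0 0 J : Matrix (Fin l ⊕ ι) (Fin l ⊕ ι) k) i j := by
  obtain ⟨N, hNW, hdis, hsup, hrank, hN⟩ := exists_nondegenerate_complement hr W
  obtain ⟨hcard, w, hwN, hw⟩ := hnf N (by omega) hN
  have hwi := linearIndependent_of_gram hJ hw
  have hspan : Submodule.span k (Set.range w) = N := by
    refine Submodule.eq_of_le_of_finrank_eq (Submodule.span_le.2 ?_) ?_
    · rintro _ ⟨i, rfl⟩
      exact hwN i
    · rw [finrank_span_eq_card hwi, hcard]
      omega
  let b : Module.Basis (Fin l) k (isoRadical B W) := Module.finBasisOfFinrankEq k _ hl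
  have hb : Submodule.span k (Set.range fun i => (b i : Fin n → k)) = isoRadical B W := by
    have := congrArg (Submodule.map (isoRadical B W).subtype) b.span_eq
    rw [Submodule.map_span, ← Set.range_comp, Submodule.map_top, Submodule.range_subtype] at this
    exact this
  have hbi : LinearIndependent k fun i => (b i : Fin n → k) :=
    b.linearIndependent.map' (isoRadical B W).subtype (Submodule.ker_subtype _)
  refine ⟨Sum.elim (fun i => (b i : Fin n → k)) w, ?_, ?_, ?_⟩
  · exact hbi.sum_type hwi (by rw [hb, hspan]; exact hdis)
  · rw [Set.Sum.elim_range, Submodule.span_union, hb, hspan, hsup]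
  · have h1 : ∀ i, ∀ x ∈ W, B x (b i) = 0 := fun i x hx => (b i).2.2 x hx
    rintro (i | i) (j | j)
    · exact h1 j _ (b i).2.1
    · exact hr _ _ (h1 i _ (hNW (hwN j)))
    · exact h1 j _ (hNW (hwN i))
    · exact hw i j

lemma exists_orthonormal_family [IsAlgClosed k] (h2 : (2 : k) ≠ 0) (hs : B.IsSymm) (m : ℕ)
    (N : Submodule k (Fin n → k)) (hm : Module.finrank k N = m)
    (hN : ∀ x ∈ N, (∀ y ∈ N, B x y = 0) → x = 0) :
    ∃ w : Fin m → Fin n → k, (∀ i, w i ∈ N) ∧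
      ∀ i j, B (w i) (w j) = (1 : Matrix (Fin m) (Fin m) k) i j := by
  subst hm
  let _ : Invertible (2 : k) := invertibleOfNonzero h2
  obtain ⟨v, hv⟩ := LinearMap.BilinForm.exists_orthogonal_basis (B := B.restrict N)
    (LinearMap.BilinForm.isSymm_iff.1 (hs.restrict N))
  have hv' : ∀ i j, i ≠ j → B (v i) (v j) = 0 := fun i j hij => hv hij
  have hvne : ∀ i, B (v i) (v i) ≠ 0 := by
    intro i h0
    have h1 : B.restrict N (v i) = 0 := v.ext fun j => by
      by_cases hij : i = j
      · subst hij; exact h0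
      · exact hv' i j hij
    exact v.ne_zero i (Subtype.ext (hN _ (v i).2 fun y hy => LinearMap.congr_fun h1 ⟨y, hy⟩))
  -- Square roots of the inverse norms rescale the orthogonal basis to an orthonormal one.
  choose c hc using fun i => IsAlgClosed.exists_eq_mul_self (B (v i) (v i))⁻¹
  refine ⟨fun i => c i • (v i : Fin n → k), fun i => N.smul_mem _ (v i).2, fun i j => ?_⟩
  simp only [map_smul, LinearMap.smul_apply, smul_eq_mul]
  by_cases hij : i = j
  · subst hij
    rw [Matrix.one_apply_eq, ← mul_assoc, ← hc, inv_mul_cancel₀ (hvne i)]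
  · rw [hv' i j hij, Matrix.one_apply_ne hij, mul_zero, mul_zero]

lemma exists_hyperbolic_complement (hs : IsSkewSymm B) (ha : ∀ x, B x x = 0)
    {N : Submodule k (Fin n → k)} (hN : ∀ x ∈ N, (∀ y ∈ N, B x y = 0) → x = 0) (h0 : N ≠ ⊥) :
    ∃ x ∈ N, ∃ y ∈ N, B x y = 1 ∧ ∃ N' ≤ N, (∀ z ∈ N', B x z = 0 ∧ B y z = 0) ∧
      Module.finrank k N = Module.finrank k N' + 2 ∧
      ∀ z ∈ N', (∀ z' ∈ N', B z z' = 0) → z = 0 := by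
  obtain ⟨x, hx, hx0⟩ := (Submodule.ne_bot_iff N).1 h0
  have h1 : ∃ y ∈ N, B x y ≠ 0 := by
    by_contra! hcon
    exact hx0 (hN x hx hcon)
  obtain ⟨y₀, hy₀, hxy₀⟩ := h1
  set y := (B x y₀)⁻¹ • y₀ with hy
  have hyN : y ∈ N := N.smul_mem _ hy₀
  have hxy : B x y = 1 := by simp [hy, hxy₀]
  have hyx : B y x = -1 := by rw [hs, hxy]
  let N' : Submodule k (Fin n → k) := N ⊓ (LinearMap.ker (B x) ⊓ LinearMap.ker (B y))
  have hN' : ∀ z, z ∈ N' ↔ z ∈ N ∧ B x z = 0 ∧ B y z = 0 := fun z => Iff.rfl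
  -- Subtracting the component in the hyperbolic plane of `x` and `y` projects `N` onto the
  -- orthogonal `N'` of that plane.
  have hproj : ∀ z ∈ N, z - B x z • y + B y z • x ∈ N' := by
    intro z hz
    refine (hN' _).2 ⟨add_mem (sub_mem hz (N.smul_mem _ hyN)) (N.smul_mem _ hx), ?_, ?_⟩
    · simp [hxy, ha]
    · simp [hyx, ha]
  refine ⟨x, hx, y, hyN, hxy, N', inf_le_left, fun z hz => hz.2, ?_, fun z hz hzz => ?_⟩
  · have hli : LinearIndependent k ![x, y] := by
      refine linearIndependent_of_gram (B := B) (J := !![0, 1; -1, 0]) (by simp) ?_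
      intro i j
      fin_cases i <;> fin_cases j <;> simp [ha, hxy, hyx]
    have hP := finrank_span_eq_card hli
    rw [Fintype.card_fin] at hP
    have hrange : Set.range ![x, y] = {x, y} := by simp [Set.pair_comm]
    rw [hrange] at hP
    have hsum := Submodule.finrank_sup_add_finrank_inf_eq N' (Submodule.span k {x, y})
    have hsup : N' ⊔ Submodule.span k {x, y} = N := by
      refine le_antisymm (sup_le inf_le_left (Submodule.span_le.2 ?_)) fun z hz => ?_
      · rintro z (rfl | rfl)
        exacts [hx, hyN]
      · refine Submodule.mem_sup.2 ⟨_, hproj z hz, B x z • y - B y z • x, ?_, by abel⟩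
        exact sub_mem (Submodule.smul_mem _ _ (Submodule.subset_span (by simp)))
          (Submodule.smul_mem _ _ (Submodule.subset_span (by simp)))
    have hinf : N' ⊓ Submodule.span k {x, y} = ⊥ := by
      rw [eq_bot_iff]
      rintro z ⟨hz, hz'⟩
      obtain ⟨a, b, rfl⟩ := Submodule.mem_span_pair.1 hz'
      obtain ⟨-, e1, e2⟩ := (hN' _).1 hz
      simp only [map_add, map_smul, ha, hxy, hyx, smul_eq_mul, mul_zero, zero_add, mul_one,
        add_zero, mul_neg, neg_eq_zero] at e1 e2
      simp [e1, e2]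
    rw [hsup, hinf, finrank_bot, add_zero, hP] at hsum
    exact hsum
  · refine hN z hz.1 fun w hw => ?_
    have h3 := hzz _ (hproj w hw)
    have h4 : B z x = 0 := by rw [hs, hz.2.1, neg_zero]
    have h5 : B z y = 0 := by rw [hs, hz.2.2, neg_zero]
    simpa [h4, h5] using h3

/-- Hyperbolic planes are split off two dimensions at a time. The Gram matrix is fixed before `N`,
so that two subspaces of the same dimension receive the same one. -/
lemma exists_symplectic_family (hs : IsSkewSymm B) (ha : ∀ x, B x x = 0) (m : ℕ) :
    ∃ (ι : Type) (_ : Fintype ι) (_ : DecidableEq ι) (J : Matrix ι ι k), J.det ≠ 0 ∧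
      ∀ N : Submodule k (Fin n → k), Module.finrank k N = m →
      (∀ x ∈ N, (∀ y ∈ N, B x y = 0) → x = 0) →
      Fintype.card ι = m ∧
        ∃ w : ι → Fin n → k, (∀ i, w i ∈ N) ∧ ∀ i j, B (w i) (w j) = J i j := by
  have hbot : ∀ {N : Submodule k (Fin n → k)} {a : ℕ}, Module.finrank k N = a + 1 → N ≠ ⊥ := by
    rintro N a h rfl
    rw [finrank_bot] at h
    omega
  induction m using Nat.twoStepInduction with
  | zero => exact ⟨Fin 0, inferInstance, inferInstance, 1, by simp, fun N _ _ =>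
      ⟨rfl, finZeroElim, fun i => i.elim0, fun i => i.elim0⟩⟩
  | one =>
    refine ⟨Fin 0, inferInstance, inferInstance, 1, by simp, fun N hm hN => ?_⟩
    obtain ⟨x, -, y, -, -, N', -, -, h, -⟩ := exists_hyperbolic_complement hs ha hN (hbot hm)
    omega
  | more m ih _ =>
    obtain ⟨ι, _, _, J, hJ, h⟩ := ih
    refine ⟨Fin 2 ⊕ ι, inferInstance, inferInstance,
      Matrix.fromBlocks !![0, 1; -1, 0] 0 0 J, ?_, fun N hm hN => ?_⟩
    · rw [Matrix.det_fromBlocks_zero₂₁]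
      simpa using hJ
    · obtain ⟨x, hx, y, hy, hxy, N', hN'N, hperp, hrank, hN'⟩ :=
        exists_hyperbolic_complement hs ha hN (hbot hm)
      obtain ⟨hcard, w, hwN, hw⟩ := h N' (by omega) hN'
      have hyx : B y x = -1 := by rw [hs, hxy]
      refine ⟨by simp [hcard]; omega, Sum.elim ![x, y] w, ?_, ?_⟩
      · rintro (i | i)
        · fin_cases i
          exacts [hx, hy]
        · exact hN'N (hwN i)
      · rintro (i | i) (j | j)
        · fin_cases i <;> fin_cases j <;> simp [ha, hxy, hyx]
        · fin_cases i
          · simpa using (hperp _ (hwN j)).1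
          · simpa using (hperp _ (hwN j)).2
        · have h1 := hperp _ (hwN i)
          fin_cases j
          · simpa using (hs _ _).trans (by rw [h1.1, neg_zero])
          · simpa using (hs _ _).trans (by rw [h1.2, neg_zero])
        · simpa using hw i j

lemma map_span_range {ι : Type*} {w w' : ι → Fin n → k} {g : (Fin n → k) ≃ₗ[k] (Fin n → k)}
    (h : ∀ i, g (w i) = w' i) : (Submodule.span k (Set.range w)).map g.toLinearMap =
      Submodule.span k (Set.range w') := by
  rw [Submodule.map_span, ← Set.range_comp]
  congr 2
  funext i
  exact h i

/-- Witt's theorem for subspaces, symmetric case. -/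
theorem exists_reflections_map_eq [IsAlgClosed k] (h2 : (2 : k) ≠ 0) (hB : B.Nondegenerate)
    (hs : B.IsSymm) {l d : ℕ} {W W' : Submodule k (Fin n → k)} (hW : W ∈ isoGrassmannian B l d)
    (hW' : W' ∈ isoGrassmannian B l d) :
    ∃ g ∈ reflectionMonoid B, W' = W.map g.toLinearMap := by
  have hs' : ∀ x y, B x y = B y x := fun x y => hs.eq x y
  have hld : l ≤ d := by
    rw [← hW.1, ← hW.2]
    exact Submodule.finrank_mono inf_le_left
  obtain ⟨m, rfl⟩ := Nat.exists_eq_add_of_le hld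
  have hnf := fun N hm hN => (⟨Fintype.card_fin m, exists_orthonormal_family h2 hs m N hm hN⟩ :
    Fintype.card (Fin m) = m ∧ _)
  obtain ⟨w, hw, hwW, hwB⟩ := exists_adapted_family hs.isRefl
    (by rw [Matrix.det_one]; exact one_ne_zero) hnf hW.2 hW.1
  obtain ⟨w', hw', hwW', hwB'⟩ := exists_adapted_family hs.isRefl
    (by rw [Matrix.det_one]; exact one_ne_zero) hnf hW'.2 hW'.1
  obtain ⟨g, hg, hgw⟩ := exists_reflections_map_family h2 hB hs' hw hw'
    (fun i j => by rw [hwB, hwB']) fun i j hij => by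
      rw [hwB]
      rcases i with i | i <;> rcases j with j | j
      · rfl
      · rfl
      · rfl
      · exact Matrix.one_apply_ne fun h => hij (congrArg _ h)
  exact ⟨g, hg, by rw [← hwW, ← hwW', map_span_range hgw]⟩

/-- Witt's theorem for subspaces, skew-symmetric case. -/
theorem exists_transvections_map_eq (hB : B.Nondegenerate)
    (hs : IsSkewSymm B) (ha : ∀ x, B x x = 0) {l d : ℕ} {W W' : Submodule k (Fin n → k)}
    (hW : W ∈ isoGrassmannian B l d) (hW' : W' ∈ isoGrassmannian B l d) :
    ∃ g ∈ linkedMonoid B, W' = W.map g.toLinearMap := by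
  have hr : B.IsRefl := fun x y hxy => by rw [hs, hxy, neg_zero]
  have hld : l ≤ d := by
    rw [← hW.1, ← hW.2]
    exact Submodule.finrank_mono inf_le_left
  obtain ⟨m, rfl⟩ := Nat.exists_eq_add_of_le hld
  obtain ⟨ι, _, _, J, hJ, hnf⟩ := exists_symplectic_family hs ha m
  obtain ⟨w, hw, hwW, hwB⟩ := exists_adapted_family hr hJ hnf hW.2 hW.1
  obtain ⟨w', hw', hwW', hwB'⟩ := exists_adapted_family hr hJ hnf hW'.2 hW'.1
  obtain ⟨g, hg, hgw⟩ := exists_transvections_map_family hB hs ha hw hw'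
    fun i j => by rw [hwB, hwB']
  exact ⟨g, hg, by rw [← hwW, ← hwW', map_span_range hgw]⟩

end NormalForms

/-! ### Action of isometries on the loci and the irreducible case. -/

section Conjugation

variable {k : Type*} [Field k] {n r : ℕ} {B : LinearMap.BilinForm k (Fin n → k)}

lemma rho_apply (hB : B.Nondegenerate) (A : Module.End k (Fin n → k)) (x y : Fin n → k) :
    B (rho B hB A x) y = B x (A y) := by
  rw [← LinearMap.BilinForm.toDual_def hB]
  simp [rho, LinearMap.BilinForm.toDual_def]

lemma eq_of_forall_form_eq (hB : B.Nondegenerate) {x x' : Fin n → k}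
    (h : ∀ y, B x y = B x' y) : x = x' := by
  rw [← sub_eq_zero]
  exact hB.1 _ fun y => by rw [map_sub, LinearMap.sub_apply, h, sub_self]

lemma isometry_symm {g : (Fin n → k) ≃ₗ[k] (Fin n → k)} (hg : ∀ x y, B (g x) (g y) = B x y)
    (x y : Fin n → k) : B (g.symm x) (g.symm y) = B x y := by
  rw [← hg, g.apply_symm_apply, g.apply_symm_apply]

lemma rho_conj (hB : B.Nondegenerate) {g : (Fin n → k) ≃ₗ[k] (Fin n → k)}
    (hg : ∀ x y, B (g x) (g y) = B x y) (A : Module.End k (Fin n → k)) :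
    rho B hB (g.toLinearMap ∘ₗ A ∘ₗ g.symm.toLinearMap) =
      g.toLinearMap ∘ₗ rho B hB A ∘ₗ g.symm.toLinearMap := by
  refine LinearMap.ext fun x => eq_of_forall_form_eq hB fun y => ?_
  rw [rho_apply]
  simp only [LinearMap.comp_apply, LinearEquiv.coe_coe]
  rw [← isometry_symm hg, g.symm_apply_apply, ← rho_apply hB, ← hg, g.apply_symm_apply]

lemma map_conj_le {g : (Fin n → k) ≃ₗ[k] (Fin n → k)} {W : Submodule k (Fin n → k)}
    {A : Module.End k (Fin n → k)} (h : W.map A ≤ W) :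
    (W.map g.toLinearMap).map (g.toLinearMap ∘ₗ A ∘ₗ g.symm.toLinearMap) ≤
      W.map g.toLinearMap := by
  rintro _ ⟨_, ⟨w, hw, rfl⟩, rfl⟩
  refine ⟨A w, h ⟨w, hw, rfl⟩, ?_⟩
  simp

lemma conjTuple_mem_zSubspace (hB : B.Nondegenerate) {g : (Fin n → k) ≃ₗ[k] (Fin n → k)}
    (hg : ∀ x y, B (g x) (g y) = B x y) {W : Submodule k (Fin n → k)} {A : EndTuple k n r}
    (hA : A ∈ zSubspace r B hB W) : conjTuple g A ∈ zSubspace r B hB (W.map g.toLinearMap) := by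
  refine fun i => ⟨map_conj_le (hA i).1, ?_⟩
  rw [conjTuple, rho_conj hB hg]
  exact map_conj_le (hA i).2

lemma isotropyRank_map {g : (Fin n → k) ≃ₗ[k] (Fin n → k)} (hg : ∀ x y, B (g x) (g y) = B x y)
    (W : Submodule k (Fin n → k)) : isotropyRank B (W.map g.toLinearMap) = isotropyRank B W := by
  have : isoRadical B (W.map g.toLinearMap) = (isoRadical B W).map g.toLinearMap := by
    ext x
    constructor
    · rintro ⟨⟨w, hw, rfl⟩, hx⟩
      refine ⟨w, ⟨hw, fun y hy => ?_⟩, rfl⟩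
      have : B (g y) (g w) = 0 := hx _ ⟨y, hy, rfl⟩
      rwa [hg] at this
    · rintro ⟨w, ⟨hw, hx⟩, rfl⟩
      refine ⟨⟨w, hw, rfl⟩, ?_⟩
      rintro _ ⟨y, hy, rfl⟩
      change B (g y) (g w) = 0
      rw [hg]
      exact hx y hy
  rw [isotropyRank, this, LinearEquiv.finrank_map_eq g]
  rfl

lemma finrank_map (g : (Fin n → k) ≃ₗ[k] (Fin n → k)) (W : Submodule k (Fin n → k)) :
    Module.finrank k (W.map g.toLinearMap) = Module.finrank k W :=
  LinearEquiv.finrank_map_eq g W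

lemma map_mem_isoGrassmannian {g : (Fin n → k) ≃ₗ[k] (Fin n → k)}
    (hg : ∀ x y, B (g x) (g y) = B x y) {l d : ℕ} {W : Submodule k (Fin n → k)}
    (hW : W ∈ isoGrassmannian B l d) : W.map g.toLinearMap ∈ isoGrassmannian B l d :=
  ⟨(finrank_map g W).trans hW.1, (isotropyRank_map hg W).trans hW.2⟩

lemma conjTuple_mem_zGe (hB : B.Nondegenerate) {g : (Fin n → k) ≃ₗ[k] (Fin n → k)}
    (hg : ∀ x y, B (g x) (g y) = B x y) {l d : ℕ} {A : EndTuple k n r}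
    (hA : A ∈ zGe l d r B hB) : conjTuple g A ∈ zGe l d r B hB := by
  obtain ⟨W, hd, hl, hA⟩ := hA
  exact ⟨W.map g.toLinearMap, by rw [finrank_map, hd], by rwa [isotropyRank_map hg],
    conjTuple_mem_zSubspace hB hg hA⟩

lemma conjTuple_symm (g : (Fin n → k) ≃ₗ[k] (Fin n → k)) (A : EndTuple k n r) :
    conjTuple g (conjTuple g.symm A) = A := by
  have := conjTuple_mul g g⁻¹ A
  rw [mul_inv_cancel, conjTuple_one] at this
  exact this.symm

lemma conjTuple_symm' (g : (Fin n → k) ≃ₗ[k] (Fin n → k)) (A : EndTuple k n r) :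
    conjTuple g.symm (conjTuple g A) = A :=
  conjTuple_symm g.symm A

lemma conjTuple_mem_zLocus (hB : B.Nondegenerate) {g : (Fin n → k) ≃ₗ[k] (Fin n → k)}
    (hg : ∀ x y, B (g x) (g y) = B x y) {l d : ℕ} {A : EndTuple k n r}
    (hA : A ∈ zLocus l d r B hB) : conjTuple g A ∈ zLocus l d r B hB := by
  refine ⟨conjTuple_mem_zGe hB hg hA.1, fun h => hA.2 ?_⟩
  have := conjTuple_mem_zGe hB (isometry_symm hg) h
  rwa [conjTuple_symm'] at this

lemma map_symm_map (g : (Fin n → k) ≃ₗ[k] (Fin n → k)) (W : Submodule k (Fin n → k)) :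
    (W.map g.toLinearMap).map g.symm.toLinearMap = W := by
  rw [← Submodule.map_comp, LinearEquiv.symm_comp, Submodule.map_id]

lemma isPreirreducible_zSubspace_diff [Infinite k] (hB : B.Nondegenerate)
    (W : Submodule k (Fin n → k)) {F : Set (EndTuple k n r)} (hF : IsClosed F) :
    IsPreirreducible (zSubspace r B hB W \ F) := by
  refine isPreirreducible_of_lines hF fun A hA A' hA' t i => ⟨?_, ?_⟩
  · rintro _ ⟨w, hw, rfl⟩
    exact add_mem ((hA i).1 ⟨w, hw, rfl⟩)
      (W.smul_mem t (sub_mem ((hA' i).1 ⟨w, hw, rfl⟩) ((hA i).1 ⟨w, hw, rfl⟩)))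
  · have : rho B hB (A i + t • (A' i - A i)) =
        rho B hB (A i) + t • (rho B hB (A' i) - rho B hB (A i)) := by
      change rhoHom B hB _ = _
      rw [map_add, map_smul, map_sub]
      rfl
    rw [this]
    rintro _ ⟨w, hw, rfl⟩
    exact add_mem ((hA i).2 ⟨w, hw, rfl⟩)
      (W.smul_mem t (sub_mem ((hA' i).2 ⟨w, hw, rfl⟩) ((hA i).2 ⟨w, hw, rfl⟩)))

lemma isClosed_zGe [IsAlgClosed k] (hB : B.Nondegenerate) (l d : ℕ) :
    IsClosed (zGe l d r B hB) := by
  have := isClosed_setOf_exists_invariant (r := r) B hB l d ∅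
  simpa [zGe] using this

/-- If the linked isometries act transitively on the subspaces of given dimension and isotropy
rank, then the corresponding locus is irreducible. -/
theorem isPreirreducible_zLocus [IsAlgClosed k] (hB : B.Nondegenerate) (l d : ℕ)
    (htrans : ∀ W ∈ isoGrassmannian B l d, ∀ W' ∈ isoGrassmannian B l d,
      ∃ g ∈ linkedMonoid B, W' = W.map g.toLinearMap) :
    IsPreirreducible (zLocus l d r B hB) := by
  have : Infinite k := IsAlgClosed.instInfinite
  refine isPreirreducible_of_linked_transitive (B := B)
    (fun h hh A hA => conjTuple_mem_zLocus hB hh.1 hA) (isoGrassmannian B l d)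
    (fun W => zSubspace r B hB W \ zGe (l + 1) d r B hB) ?_ ?_
    (fun W _ => isPreirreducible_zSubspace_diff hB W (isClosed_zGe hB _ _)) ?_
  · exact fun W hW A hA => ⟨⟨W, hW.1, hW.2.ge, hA.1⟩, hA.2⟩
  · rintro A ⟨⟨W, hW, hl, hA⟩, hA'⟩
    -- A witness of isotropy rank above `l` would place `A` in the removed set.
    refine ⟨W, ⟨hW, le_antisymm ?_ hl⟩, hA, hA'⟩
    by_contra! hcon
    exact hA' ⟨W, hW, hcon, hA⟩
  · intro W hW W' hW'
    obtain ⟨g, hg, rfl⟩ := htrans W hW W' hW'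
    have hiso := (isSpecial_of_mem_linkedMonoid hg).1
    refine ⟨g, hg, fun A hA => ⟨conjTuple g.symm A, ⟨?_, fun h => hA.2 ?_⟩, conjTuple_symm g A⟩⟩
    · have := conjTuple_mem_zSubspace hB (isometry_symm hiso) hA.1
      rwa [map_symm_map] at this
    · have := conjTuple_mem_zGe hB hiso h
      rwa [conjTuple_symm] at this

lemma map_orthReflection_of_mem {W : Submodule k (Fin n → k)} {v : Fin n → k}
    (h : v ∈ W ∨ ∀ w ∈ W, B v w = 0) : W.map (orthReflection B v).toLinearMap = W := by
  have hle : W.map (orthReflection B v).toLinearMap ≤ W := by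
    rintro _ ⟨w, hw, rfl⟩
    rw [LinearEquiv.coe_coe]
    rcases h with h | h
    · by_cases hv : B v v ≠ 0
      · rw [orthReflection_apply hv]
        exact sub_mem hw (W.smul_mem _ h)
      · rw [orthReflection, dif_neg hv]
        exact hw
    · rwa [orthReflection_fix (h w hw)]
  exact Submodule.eq_of_le_of_finrank_eq hle (finrank_map _ W)

lemma form_eq_zero_of_isotropic (h2 : (2 : k) ≠ 0) (hs : ∀ x y, B x y = B y x)
    {W : Submodule k (Fin n → k)} (h : ∀ w ∈ W, B w w = 0) :
    ∀ w ∈ W, ∀ w' ∈ W, B w w' = 0 := by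
  intro w hw w' hw'
  have h1 := h _ (add_mem hw hw')
  simp only [map_add, LinearMap.add_apply, h w hw, h w' hw', hs w' w] at h1
  have : 2 * B w w' = 0 := by linear_combination h1
  simpa [h2] using this

/-- An odd product of reflections taking `W` to `W'` can be preceded by a reflection stabilising
`W`, in an anisotropic vector of `W` or of its orthogonal. If there is none, both spaces are totally
isotropic, hence equal, which forces `2 * d = n` and `l = d`. -/
lemma exists_linked_map_eq_of_anisotropic [IsAlgClosed k] (h2 : (2 : k) ≠ 0)
    (hB : B.Nondegenerate) (hs : B.IsSymm) {l d : ℕ} {W W' : Submodule k (Fin n → k)}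
    (hW : W ∈ isoGrassmannian B l d) (hW' : W' ∈ isoGrassmannian B l d)
    (hexc : ¬ (2 * d = n ∧ l = d)) :
    ∃ g ∈ linkedMonoid B, W' = W.map g.toLinearMap := by
  have hs' : ∀ x y, B x y = B y x := fun x y => hs.eq x y
  obtain ⟨g, hg, hgW⟩ := exists_reflections_map_eq h2 hB hs hW hW'
  rcases mem_linkedMonoid_or_mul_reflection_mem hs' hg with hg' | hg'
  · exact ⟨g, hg', hgW⟩
  have hv : ∃ v, B v v ≠ 0 ∧ W.map (orthReflection B v).toLinearMap = W := by
    by_contra! hcon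
    have h1 : ∀ w ∈ W, B w w = 0 := fun w hw => by
      by_contra h
      exact hcon w h (map_orthReflection_of_mem (.inl hw))
    have h3 : ∀ w ∈ B.orthogonal W, B w w = 0 := fun w hw => by
      by_contra h
      exact hcon w h (map_orthReflection_of_mem (.inr fun w' hw' => by
        rw [hs']; exact hw w' hw'))
    have h4 : W ≤ B.orthogonal W := fun w hw w' hw' =>
      form_eq_zero_of_isotropic h2 hs' h1 w' hw' w hw
    have h5 : B.orthogonal W ≤ W := by
      intro w hw
      rw [← LinearMap.BilinForm.orthogonal_orthogonal hB hs.isRefl W]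
      intro w' hw'
      exact form_eq_zero_of_isotropic h2 hs' h3 w' hw' w hw
    have h6 : B.orthogonal W = W := le_antisymm h5 h4
    have h7 := LinearMap.BilinForm.finrank_orthogonal hB W
    have h8 : isoRadical B W = W := inf_eq_left.2 h4
    have h9 := hW.2
    have h10 := Submodule.finrank_le W
    rw [isotropyRank, h8, hW.1] at h9
    rw [h6, hW.1, Module.finrank_fin_fun] at h7
    rw [hW.1, Module.finrank_fin_fun] at h10
    exact hexc ⟨by omega, h9.symm⟩
  obtain ⟨v, hv, hvW⟩ := hv
  refine ⟨_, hg' v hv, ?_⟩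
  have : (g * orthReflection B v).toLinearMap =
      g.toLinearMap ∘ₗ (orthReflection B v).toLinearMap := rfl
  rw [this, Submodule.map_comp, hvW, hgW]

lemma skew_self_eq_zero (h2 : (2 : k) ≠ 0) (hs : IsSkewSymm B) (x : Fin n → k) : B x x = 0 := by
  have : 2 * B x x = 0 := by linear_combination hs x x
  simpa [h2] using this

theorem isIrreducible_zLocus [IsAlgClosed k] (h2 : (2 : k) ≠ 0)
    (hB : B.Nondegenerate) (hsymm : B.IsSymm ∨ IsSkewSymm B) {l d : ℕ}
    (hne : (zLocus l d r B hB).Nonempty) (hexc : ¬ (B.IsSymm ∧ 2 * d = n ∧ l = d)) :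
    IsIrreducible (zLocus l d r B hB) := by
  refine ⟨hne, isPreirreducible_zLocus hB l d fun W hW W' hW' => ?_⟩
  by_cases hs : B.IsSymm
  · exact exists_linked_map_eq_of_anisotropic h2 hB hs hW hW' fun h => hexc ⟨hs, h⟩
  · have hs' := hsymm.resolve_left hs
    exact exists_transvections_map_eq hB hs' (skew_self_eq_zero h2 hs') hW hW'

end Conjugation

/-! ### Lagrangian subspaces and their two orbits. -/

section Lagrangian

variable {k : Type*} [Field k] {n r : ℕ} {B : LinearMap.BilinForm k (Fin n → k)}

lemma le_orthogonal_of_mem {d : ℕ} {W : Submodule k (Fin n → k)}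
    (hW : W ∈ isoGrassmannian B d d) : W ≤ B.orthogonal W := by
  have : isoRadical B W = W :=
    Submodule.eq_of_le_of_finrank_eq inf_le_left (by rw [hW.1]; exact hW.2)
  exact inf_eq_left.1 this

lemma mem_isoGrassmannian_self {d : ℕ} {W : Submodule k (Fin n → k)}
    (hW : Module.finrank k W = d) (h : W ≤ B.orthogonal W) : W ∈ isoGrassmannian B d d :=
  ⟨hW, by rw [isotropyRank, isoRadical, inf_eq_left.2 h, hW]⟩

lemma orthogonal_eq_self (hB : B.Nondegenerate) {d : ℕ} (hn : 2 * d = n)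
    {W : Submodule k (Fin n → k)} (hW : W ∈ isoGrassmannian B d d) : B.orthogonal W = W := by
  refine (Submodule.eq_of_le_of_finrank_eq (le_orthogonal_of_mem hW) ?_).symm
  rw [LinearMap.BilinForm.finrank_orthogonal hB, hW.1, Module.finrank_fin_fun]
  omega

/-- If `A` preserves `W`, its adjoint preserves the orthogonal of `W`, which is `W` itself. -/
lemma mem_zSubspace_of_forall_map_le (hB : B.Nondegenerate) (hs : ∀ x y, B x y = B y x)
    {W : Submodule k (Fin n → k)} (hW : B.orthogonal W = W) {A : EndTuple k n r}
    (hA : ∀ i, W.map (A i) ≤ W) : A ∈ zSubspace r B hB W := by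
  refine fun i => ⟨hA i, ?_⟩
  rintro _ ⟨w, hw, rfl⟩
  rw [← hW]
  intro y hy
  change B y _ = 0
  rw [hs, rho_apply, hs]
  rw [← hW] at hw
  exact hs w _ ▸ (hs _ _).trans (hw _ (hA i ⟨y, hy, rfl⟩))

/-- An isometry preserving a Lagrangian subspace has determinant one. -/
lemma det_eq_one_of_map_eq (hB : B.Nondegenerate) (hs : ∀ x y, B x y = B y x)
    {W : Submodule k (Fin n → k)} (hW : B.orthogonal W = W) {g : (Fin n → k) ≃ₗ[k] (Fin n → k)}
    (hg : ∀ x y, B (g x) (g y) = B x y) (hgW : W.map g.toLinearMap = W) :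
    LinearMap.det g.toLinearMap = 1 := by
  have hle : W ≤ W.comap g.toLinearMap := Submodule.map_le_iff_le_comap.1 hgW.le
  rw [LinearMap.det_eq_det_mul_det W g.toLinearMap hle]
  -- The form identifies the quotient by `W` with the dual of `W`.
  let φ : (Fin n → k) →ₗ[k] Module.Dual k W := W.subtype.dualMap ∘ₗ (B.toDual hB).toLinearMap
  have hφ : ∀ v (w : W), φ v w = B v w := fun v w => LinearMap.BilinForm.toDual_def hB
  have hsurj : Function.Surjective φ :=
    (LinearMap.dualMap_surjective_of_injective W.injective_subtype).comp (B.toDual hB).surjective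
  have hker : LinearMap.ker φ = W := by
    conv_rhs => rw [← hW]
    ext v
    rw [LinearMap.mem_ker]
    constructor
    · intro h w hw
      change B w v = 0
      rw [hs, ← hφ v ⟨w, hw⟩, h, LinearMap.zero_apply]
    · intro h
      refine LinearMap.ext fun w => ?_
      rw [hφ, hs]
      exact h w w.2
  let e : ((Fin n → k) ⧸ W) ≃ₗ[k] Module.Dual k W :=
    (Submodule.quotEquivOfEq _ _ hker.symm).trans (φ.quotKerEquivOfSurjective hsurj)
  have he : ∀ v, e (Submodule.Quotient.mk v) = φ v := fun v => rfl
  set gW := g.toLinearMap.restrict hle with hgWdef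
  set gQ := W.mapQ W g.toLinearMap hle with hgQ
  -- Under that identification the map induced on the quotient is inverse to the transpose of the
  -- restriction to `W`, so the two determinants multiply to one.
  have hcomp : (e.symm.toLinearMap ∘ₗ gW.dualMap ∘ₗ e.toLinearMap) ∘ₗ gQ = LinearMap.id := by
    refine Submodule.linearMap_qext _ (LinearMap.ext fun v => ?_)
    simp only [LinearMap.comp_apply, LinearEquiv.coe_coe, Submodule.mkQ_apply, hgQ,
      Submodule.mapQ_apply, LinearMap.id_apply]
    rw [LinearEquiv.symm_apply_eq, he, he]
    refine LinearMap.ext fun w => ?_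
    rw [LinearMap.dualMap_apply, hφ, hφ]
    exact hg v w
  have hdet := congrArg LinearMap.det hcomp
  rw [LinearMap.det_comp, LinearMap.det_id] at hdet
  have hconj : LinearMap.det (e.symm.toLinearMap ∘ₗ gW.dualMap ∘ₗ e.toLinearMap) =
      LinearMap.det gW.dualMap := LinearMap.det_conj gW.dualMap e.symm
  rw [hconj, LinearMap.det_dualMap] at hdet
  exact hdet

lemma exists_linearEquiv_eq {g : Module.End k (Fin n → k)} (hg : LinearMap.det g = 1) :
    ∃ e : (Fin n → k) ≃ₗ[k] (Fin n → k), e.toLinearMap = g :=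
  ⟨LinearMap.equivOfDetNeZero g (by rw [hg]; exact one_ne_zero), rfl⟩

lemma mem_soOrbit_iff {W U : Submodule k (Fin n → k)} :
    U ∈ soOrbit B W ↔ ∃ g, IsSpecial B g ∧ U = W.map g.toLinearMap := by
  constructor
  · rintro ⟨g, hg, hdet, rfl⟩
    obtain ⟨e, rfl⟩ := exists_linearEquiv_eq hdet
    exact ⟨e, ⟨hg, hdet⟩, rfl⟩
  · rintro ⟨g, hg, rfl⟩
    exact ⟨g.toLinearMap, hg.1, hg.2, rfl⟩

lemma IsSpecial.symm {g : (Fin n → k) ≃ₗ[k] (Fin n → k)} (hg : IsSpecial B g) :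
    IsSpecial B g.symm := by
  refine ⟨isometry_symm hg.1, ?_⟩
  have : LinearMap.det (g.toLinearMap ∘ₗ g.symm.toLinearMap) = 1 := by
    rw [LinearEquiv.comp_symm, LinearMap.det_id]
  rwa [LinearMap.det_comp, hg.2, one_mul] at this

lemma mem_soOrbit_self (W : Submodule k (Fin n → k)) : W ∈ soOrbit B W :=
  mem_soOrbit_iff.2 ⟨1, isSpecial_one, (Submodule.map_id W).symm⟩

lemma mem_soOrbit_symm {W U : Submodule k (Fin n → k)} (h : U ∈ soOrbit B W) :
    W ∈ soOrbit B U := by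
  obtain ⟨g, hg, rfl⟩ := mem_soOrbit_iff.1 h
  exact mem_soOrbit_iff.2 ⟨g.symm, hg.symm, (map_symm_map g W).symm⟩

lemma mem_soOrbit_trans {W U T : Submodule k (Fin n → k)} (h : U ∈ soOrbit B W)
    (h' : T ∈ soOrbit B U) : T ∈ soOrbit B W := by
  obtain ⟨g, hg, rfl⟩ := mem_soOrbit_iff.1 h
  obtain ⟨g', hg', rfl⟩ := mem_soOrbit_iff.1 h'
  refine mem_soOrbit_iff.2 ⟨g' * g, hg'.mul hg, ?_⟩
  rw [← Submodule.map_comp]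
  rfl

lemma soOrbit_eq_of_mem {W U : Submodule k (Fin n → k)} (h : U ∈ soOrbit B W) :
    soOrbit B U = soOrbit B W :=
  Set.Subset.antisymm (fun _ hT => mem_soOrbit_trans h hT)
    fun _ hT => mem_soOrbit_trans (mem_soOrbit_symm h) hT

lemma mem_isoGrassmannian_of_mem_soOrbit {l d : ℕ} {W U : Submodule k (Fin n → k)}
    (hW : W ∈ isoGrassmannian B l d) (h : U ∈ soOrbit B W) : U ∈ isoGrassmannian B l d := by
  obtain ⟨g, hg, rfl⟩ := mem_soOrbit_iff.1 h
  exact map_mem_isoGrassmannian hg.1 hW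

lemma exists_anisotropic (h2 : (2 : k) ≠ 0) (hn : 0 < n) (hB : B.Nondegenerate)
    (hs : ∀ x y, B x y = B y x) : ∃ v, B v v ≠ 0 := by
  by_contra! hcon
  have h := form_eq_zero_of_isotropic h2 hs (W := ⊤) fun w _ => hcon w
  have h1 : (Pi.single ⟨0, hn⟩ 1 : Fin n → k) = 0 := hB.1 _ fun y => h _ trivial _ trivial
  have := congrFun h1 ⟨0, hn⟩
  simp at this

/-- Witt's theorem gives a product of reflections `g` taking `W` to `W'`. Were it odd, then for `f`
special with the same effect, `f.symm * g` would stabilise the Lagrangian `W` and have determinant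
`-1`. -/
lemma exists_linked_map_eq_of_mem_soOrbit [IsAlgClosed k] (h2 : (2 : k) ≠ 0) (hn0 : 0 < n)
    (hB : B.Nondegenerate) (hs : B.IsSymm) {d : ℕ} (hn : 2 * d = n)
    {W W' : Submodule k (Fin n → k)} (hW : W ∈ isoGrassmannian B d d) (h : W' ∈ soOrbit B W) :
    ∃ g ∈ linkedMonoid B, W' = W.map g.toLinearMap := by
  have hs' : ∀ x y, B x y = B y x := fun x y => hs.eq x y
  have hW' := mem_isoGrassmannian_of_mem_soOrbit hW h
  obtain ⟨f, hf, hfW⟩ := mem_soOrbit_iff.1 h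
  obtain ⟨g, hg, hgW⟩ := exists_reflections_map_eq h2 hB hs hW hW'
  rcases mem_linkedMonoid_or_mul_reflection_mem hs' hg with hg' | hg'
  · exact ⟨g, hg', hgW⟩
  exfalso
  obtain ⟨v, hv⟩ := exists_anisotropic h2 hn0 hB hs'
  have hd1 : LinearMap.det g.toLinearMap = -1 := by
    have h1 := (isSpecial_of_mem_linkedMonoid (hg' v hv)).2
    change LinearMap.det (g.toLinearMap ∘ₗ (orthReflection B v).toLinearMap) = 1 at h1
    rw [LinearMap.det_comp, det_orthReflection hv] at h1
    linear_combination -h1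
  have h3 : LinearMap.det (f.symm * g).toLinearMap = 1 := by
    refine det_eq_one_of_map_eq hB hs' (orthogonal_eq_self hB hn hW) (fun x y => ?_) ?_
    · rw [LinearEquiv.mul_apply, LinearEquiv.mul_apply, isometry_symm hf.1,
        isometry_of_mem_reflectionMonoid hs' hg]
    · change W.map (f.symm.toLinearMap ∘ₗ g.toLinearMap) = W
      rw [Submodule.map_comp, ← hgW, hfW, map_symm_map]
  change LinearMap.det (f.symm.toLinearMap ∘ₗ g.toLinearMap) = 1 at h3
  rw [LinearMap.det_comp, hf.symm.2, hd1, one_mul] at h3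
  exact h2 (by linear_combination -h3)

lemma reflection_notMem_soOrbit (h2 : (2 : k) ≠ 0) (hB : B.Nondegenerate)
    (hs : ∀ x y, B x y = B y x) {d : ℕ} (hn : 2 * d = n) {W : Submodule k (Fin n → k)}
    (hW : W ∈ isoGrassmannian B d d) {v : Fin n → k} (hv : B v v ≠ 0) :
    W.map (orthReflection B v).toLinearMap ∉ soOrbit B W := by
  intro h
  obtain ⟨f, hf, hfW⟩ := mem_soOrbit_iff.1 h
  have h3 : LinearMap.det (f.symm * orthReflection B v).toLinearMap = 1 := by
    refine det_eq_one_of_map_eq hB hs (orthogonal_eq_self hB hn hW) (fun x y => ?_) ?_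
    · rw [LinearEquiv.mul_apply, LinearEquiv.mul_apply, isometry_symm hf.1,
        orthReflection_isometry hs]
    · change W.map (f.symm.toLinearMap ∘ₗ (orthReflection B v).toLinearMap) = W
      rw [Submodule.map_comp, hfW, map_symm_map]
  change LinearMap.det (f.symm.toLinearMap ∘ₗ (orthReflection B v).toLinearMap) = 1 at h3
  rw [LinearMap.det_comp, hf.symm.2, det_orthReflection hv, one_mul] at h3
  exact h2 (by linear_combination -h3)

lemma mem_soOrbit_or_mem_soOrbit [IsAlgClosed k] (h2 : (2 : k) ≠ 0)
    (hB : B.Nondegenerate) (hs : B.IsSymm) {l d : ℕ} {W W' : Submodule k (Fin n → k)}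
    (hW : W ∈ isoGrassmannian B l d) (hW' : W' ∈ isoGrassmannian B l d) {v : Fin n → k}
    (hv : B v v ≠ 0) :
    W' ∈ soOrbit B W ∨ W' ∈ soOrbit B (W.map (orthReflection B v).toLinearMap) := by
  have hs' : ∀ x y, B x y = B y x := fun x y => hs.eq x y
  obtain ⟨g, hg, hgW⟩ := exists_reflections_map_eq h2 hB hs hW hW'
  rcases mem_linkedMonoid_or_mul_reflection_mem hs' hg with hg' | hg'
  · exact .inl (mem_soOrbit_iff.2 ⟨g, isSpecial_of_mem_linkedMonoid hg', hgW⟩)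
  · refine .inr (mem_soOrbit_iff.2 ⟨_, isSpecial_of_mem_linkedMonoid (hg' v hv), ?_⟩)
    rw [← Submodule.map_comp]
    change W' = W.map ((g * orthReflection B v) * orthReflection B v).toLinearMap
    rw [mul_assoc, orthReflection_mul_self, mul_one, hgW]

end Lagrangian

/-! ### Separating the two Lagrangian families. -/

section OrbitClosures

variable {k : Type*} [Field k] {n r : ℕ} {B : LinearMap.BilinForm k (Fin n → k)}

/-- The form makes `W` dual to any complement `C`. Hence there is a map `s` from `C` to `W` with `B
(s c) c' = -B c c' / 2`, and the graph of `s` is an isotropic complement. -/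
lemma exists_isotropic_isCompl (h2 : (2 : k) ≠ 0) (hB : B.Nondegenerate)
    (hs : ∀ x y, B x y = B y x) {d : ℕ} (hn : 2 * d = n) {W : Submodule k (Fin n → k)}
    (hW : W ∈ isoGrassmannian B d d) :
    ∃ U ∈ isoGrassmannian B d d, IsCompl W U := by
  have hWW : ∀ w ∈ W, ∀ w' ∈ W, B w w' = 0 := fun w hw w' hw' => le_orthogonal_of_mem hW hw' w hw
  obtain ⟨C, hC⟩ := Submodule.exists_isCompl W
  have hCd : Module.finrank k C = d := by
    have := Submodule.finrank_add_eq_of_isCompl hC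
    rw [hW.1, Module.finrank_fin_fun] at this
    omega
  let φ : W →ₗ[k] Module.Dual k C :=
    C.subtype.dualMap ∘ₗ (B.toDual hB).toLinearMap ∘ₗ W.subtype
  have hφ : ∀ (w : W) (c : C), φ w c = B w c := fun w c => LinearMap.BilinForm.toDual_def hB
  have hinj : Function.Injective φ := by
    rw [injective_iff_map_eq_zero]
    intro w hw
    refine Subtype.ext (hB.1 _ fun y => ?_)
    have hy : y ∈ W ⊔ C := by rw [hC.sup_eq_top]; trivial
    obtain ⟨w', hw', c, hc, rfl⟩ := Submodule.mem_sup.1 hy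
    rw [map_add, hWW _ w.2 _ hw', zero_add, ← hφ w ⟨c, hc⟩, hw, LinearMap.zero_apply]
  have hdim : Module.finrank k W = Module.finrank k (Module.Dual k C) := by
    rw [Subspace.dual_finrank_eq, hCd, hW.1]
  let e : W ≃ₗ[k] Module.Dual k C := LinearEquiv.ofInjectiveOfFinrankEq φ hinj hdim
  have he : ∀ w c, e w c = B w c := fun w c => hφ w c
  let ψ : C →ₗ[k] Module.Dual k C :=
    (-(2 : k)⁻¹) • (C.subtype.dualMap ∘ₗ (B.toDual hB).toLinearMap ∘ₗ C.subtype)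
  have hψ : ∀ c c' : C, ψ c c' = -(2 : k)⁻¹ * B c c' := fun c c' => by
    simp [ψ, LinearMap.BilinForm.toDual_def]
  let s : C →ₗ[k] W := e.symm.toLinearMap ∘ₗ ψ
  have hsB : ∀ c c' : C, B (s c) c' = -(2 : k)⁻¹ * B c c' := by
    intro c c'
    rw [← he, ← hψ]
    simp [s]
  let f : C →ₗ[k] (Fin n → k) := C.subtype + W.subtype ∘ₗ s
  have hf : ∀ c, f c = c + s c := fun c => rfl
  have hfW : ∀ c, f c ∈ W → c = 0 := by
    intro c hc
    have h1 : (c : Fin n → k) ∈ W := by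
      have := sub_mem hc (s c).2
      rwa [hf, add_sub_cancel_right] at this
    exact Subtype.ext (Submodule.disjoint_def.1 hC.disjoint _ h1 c.2)
  have hfinj : Function.Injective f := by
    rw [injective_iff_map_eq_zero]
    intro c hc
    exact hfW c (by rw [hc]; exact zero_mem _)
  have hrank : Module.finrank k (LinearMap.range f) = d := by
    rw [LinearMap.finrank_range_of_inj hfinj, hCd]
  refine ⟨LinearMap.range f, mem_isoGrassmannian_self hrank ?_, ?_⟩
  · rintro _ ⟨c, rfl⟩ _ ⟨c', rfl⟩
    change B (f c') (f c) = 0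
    simp only [hf, map_add, LinearMap.add_apply, hsB, hWW _ (s c').2 _ (s c).2,
      hs (c' : Fin n → k) (s c)]
    rw [hs (c : Fin n → k) c']
    field_simp
    ring
  · rw [Submodule.isCompl_iff_disjoint _ _ (by
      rw [hrank, hW.1, Module.finrank_fin_fun]; omega), Submodule.disjoint_def]
    rintro _ hx ⟨c, rfl⟩
    rw [hfW c hx, map_zero]

/-- Two Lagrangian subspaces with a common Lagrangian complement are in the same orbit. -/
lemma mem_soOrbit_of_isCompl (hB : B.Nondegenerate) (hs : ∀ x y, B x y = B y x) {d : ℕ}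
    (hn : 2 * d = n) {W W' U : Submodule k (Fin n → k)} (hW : W ∈ isoGrassmannian B d d)
    (hW' : W' ∈ isoGrassmannian B d d) (hU : U ∈ isoGrassmannian B d d) (h : IsCompl W U)
    (h' : IsCompl W' U) : W' ∈ soOrbit B W := by
  have hiso : ∀ {T : Submodule k (Fin n → k)}, T ∈ isoGrassmannian B d d →
      ∀ w ∈ T, ∀ w' ∈ T, B w w' = 0 := fun hT w hw w' hw' => le_orthogonal_of_mem hT hw' w hw
  -- Projection along `U`, through the common quotient by `U`. The map `g` below is the identity on
  -- `U` and `ψ` on `W`; since it stabilises `U`, its determinant is one.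
  let ψ : W ≃ₗ[k] W' := (Submodule.quotientEquivOfIsCompl U W h.symm).symm.trans
    (Submodule.quotientEquivOfIsCompl U W' h'.symm)
  have hψ : ∀ w : W, (w : Fin n → k) - ψ w ∈ U := by
    intro w
    have := (Submodule.quotientEquivOfIsCompl U W' h'.symm).symm_apply_apply
      ((Submodule.quotientEquivOfIsCompl U W h.symm).symm w)
    rw [Submodule.quotientEquivOfIsCompl_symm_apply U W h.symm] at this
    exact (Submodule.Quotient.eq U).1
      ((Submodule.quotientEquivOfIsCompl_symm_apply U W' h'.symm (ψ w)).symm.trans this).symm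
  let e := Submodule.prodEquivOfIsCompl U W h.symm
  let e' := Submodule.prodEquivOfIsCompl U W' h'.symm
  let g : (Fin n → k) ≃ₗ[k] (Fin n → k) :=
    (e.symm.trans ((LinearEquiv.refl k U).prodCongr ψ)).trans e'
  have hg : ∀ (u : U) (w : W), g (u + w) = u + ψ w := by
    intro u w
    have h1 : e.symm (u + w) = (u, w) := by
      rw [LinearEquiv.symm_apply_eq]
      rfl
    simp only [g, LinearEquiv.trans_apply, h1]
    rfl
  have hex : ∀ x : Fin n → k, ∃ (u : U) (w : W), x = u + w := fun x =>
    ⟨(e.symm x).1, (e.symm x).2, (e.apply_symm_apply x).symm⟩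
  have hgiso : ∀ x y, B (g x) (g y) = B x y := by
    intro x y
    obtain ⟨u, w, rfl⟩ := hex x
    obtain ⟨u', w', rfl⟩ := hex y
    have e1 : B u (ψ w') = B u w' := by
      have := hiso hU _ u.2 _ (hψ w')
      rw [map_sub, sub_eq_zero] at this
      exact this.symm
    have e2 : B (ψ w) u' = B w u' := by
      have := hiso hU _ (hψ w) _ u'.2
      rw [map_sub, LinearMap.sub_apply, sub_eq_zero] at this
      exact this.symm
    simp only [hg, map_add, LinearMap.add_apply, e1, e2, hiso hW _ w.2 _ w'.2,
      hiso hW' _ (ψ w).2 _ (ψ w').2]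
  have hgU : U.map g.toLinearMap = U := by
    refine Submodule.eq_of_le_of_finrank_eq ?_ (finrank_map g U)
    rintro _ ⟨u, hu, rfl⟩
    have := hg ⟨u, hu⟩ 0
    simp only [map_zero, ZeroMemClass.coe_zero, add_zero] at this
    rw [LinearEquiv.coe_coe, this]
    exact hu
  have hgW : W.map g.toLinearMap = W' := by
    refine Submodule.eq_of_le_of_finrank_eq ?_ (by rw [finrank_map, hW.1, hW'.1])
    rintro _ ⟨w, hw, rfl⟩
    have := hg 0 ⟨w, hw⟩
    simp only [ZeroMemClass.coe_zero, zero_add] at this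
    rw [LinearEquiv.coe_coe, this]
    exact (ψ ⟨w, hw⟩).2
  exact mem_soOrbit_iff.2
    ⟨g, ⟨hgiso, det_eq_one_of_map_eq hB hs (orthogonal_eq_self hB hn hU) hgiso hgU⟩, hgW.symm⟩

/-- A Lagrangian `W` is outside the orbit exactly when it is complementary to some Lagrangian that
has a complement outside the orbit: a Lagrangian complement of `W` itself shows one direction, and a
common complement forces equal orbits in the other. -/
lemma isClosed_iUnion_soOrbit [IsAlgClosed k] (h2 : (2 : k) ≠ 0) (hB : B.Nondegenerate)
    (hs : ∀ x y, B x y = B y x) {d : ℕ} (hn : 2 * d = n) {W₀ : Submodule k (Fin n → k)}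
    (hW₀ : W₀ ∈ isoGrassmannian B d d) : IsClosed (⋃ W ∈ soOrbit B W₀, zSubspace r B hB W) := by
  convert isClosed_setOf_exists_invariant (r := r) B hB d d
    {U | U ∈ isoGrassmannian B d d ∧
      ∃ W' ∈ isoGrassmannian B d d, W' ∉ soOrbit B W₀ ∧ IsCompl W' U} using 1
  ext A
  simp only [Set.mem_iUnion, Set.mem_ofPred_eq]
  constructor
  · rintro ⟨W, hWO, hA⟩
    have hW := mem_isoGrassmannian_of_mem_soOrbit hW₀ hWO
    refine ⟨W, hW.1, hW.2.ge, hA, ?_⟩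
    rintro U ⟨hU, W', hW', hW'O, hc⟩ hWU
    exact hW'O (mem_soOrbit_trans hWO (mem_soOrbit_of_isCompl hB hs hn hW hW' hU hWU hc))
  · rintro ⟨W, hWd, hWl, hA, hWU⟩
    have hW : W ∈ isoGrassmannian B d d :=
      ⟨hWd, le_antisymm (by rw [← hWd]; exact Submodule.finrank_mono inf_le_left) hWl⟩
    refine ⟨W, ?_, hA⟩
    by_contra hWO
    obtain ⟨U, hU, hc⟩ := exists_isotropic_isCompl h2 hB hs hn hW
    exact hWU U ⟨hU, W, hW, hWO, hc⟩ hc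

lemma isPreirreducible_iUnion_soOrbit [IsAlgClosed k] (h2 : (2 : k) ≠ 0) (hn0 : 0 < n)
    (hB : B.Nondegenerate) (hs : B.IsSymm) {d : ℕ} (hn : 2 * d = n)
    {W₀ : Submodule k (Fin n → k)} (hW₀ : W₀ ∈ isoGrassmannian B d d) :
    IsPreirreducible (⋃ W ∈ soOrbit B W₀, zSubspace r B hB W) := by
  have : Infinite k := IsAlgClosed.instInfinite
  refine isPreirreducible_of_linked_transitive (B := B) ?_ (soOrbit B W₀)
    (fun W => zSubspace r B hB W) ?_ ?_ ?_ ?_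
  · intro h hh A hA
    simp only [Set.mem_iUnion] at hA ⊢
    obtain ⟨W, hW, hA⟩ := hA
    exact ⟨_, mem_soOrbit_trans hW (mem_soOrbit_iff.2 ⟨h, hh, rfl⟩),
      conjTuple_mem_zSubspace hB hh.1 hA⟩
  · exact fun W hW => Set.subset_biUnion_of_mem (u := fun W => zSubspace r B hB W) hW
  · intro A hA
    simpa using hA
  · intro W _
    have := isPreirreducible_zSubspace_diff (r := r) hB W isClosed_empty
    rwa [Set.sdiff_empty] at this
  · intro W hW W' hW'
    obtain ⟨g, hg, rfl⟩ := exists_linked_map_eq_of_mem_soOrbit h2 hn0 hB hs hn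
      (mem_isoGrassmannian_of_mem_soOrbit hW₀ hW) (mem_soOrbit_trans (mem_soOrbit_symm hW) hW')
    have hiso := (isSpecial_of_mem_linkedMonoid hg).1
    refine ⟨g, hg, fun A hA => ⟨conjTuple g.symm A, ?_, conjTuple_symm g A⟩⟩
    have := conjTuple_mem_zSubspace hB (isometry_symm hiso) hA
    rwa [map_symm_map] at this

/-- The shift of coordinates on `k^n`. -/
def shiftEnd (k : Type*) [Field k] (n : ℕ) : Module.End k (Fin n → k) where
  toFun x i := if h : (i : ℕ) + 1 < n then x ⟨i + 1, h⟩ else 0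
  map_add' x y := by
    funext i
    by_cases h : (i : ℕ) + 1 < n <;> simp [h]
  map_smul' c x := by
    funext i
    by_cases h : (i : ℕ) + 1 < n <;> simp [h]

lemma shiftEnd_pow_apply (m : ℕ) (x : Fin n → k) (i : Fin n) :
    (shiftEnd k n ^ m) x i = if h : (i : ℕ) + m < n then x ⟨i + m, h⟩ else 0 := by
  induction m generalizing i with
  | zero => simp
  | succ m ih =>
    rw [pow_succ', Module.End.mul_apply]
    change (if h : (i : ℕ) + 1 < n then (shiftEnd k n ^ m) x ⟨i + 1, h⟩ else 0) = _
    by_cases h : (i : ℕ) + 1 < n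
    · rw [dif_pos h, ih]
      have e : (i : ℕ) + 1 + m = i + (m + 1) := by ring
      simp only [e]
    · rw [dif_neg h, dif_neg (by omega)]

lemma finrank_ker_shiftEnd_pow_le (n m : ℕ) :
    Module.finrank k (LinearMap.ker (shiftEnd k n ^ m)) ≤ m := by
  let f : LinearMap.ker (shiftEnd k n ^ m) →ₗ[k] (Fin m → k) :=
    { toFun := fun x i => if h : (i : ℕ) < n then (x : Fin n → k) ⟨i, h⟩ else 0
      map_add' := fun x y => by
        funext i
        by_cases h : (i : ℕ) < n <;> simp [h]
      map_smul' := fun c x => by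
        funext i
        by_cases h : (i : ℕ) < n <;> simp [h] }
  have hf : Function.Injective f := by
    rw [injective_iff_map_eq_zero]
    rintro ⟨x, hx⟩ h
    refine Subtype.ext (funext fun i => ?_)
    by_cases hi : (i : ℕ) < m
    · have := congrFun h ⟨i, hi⟩
      simpa [f] using this
    · have h1 := congrFun hx ⟨i - m, by omega⟩
      rw [shiftEnd_pow_apply] at h1
      have h3 : (i : ℕ) - m + m = i := by omega
      simpa [h3] using h1
  simpa using LinearMap.finrank_le_finrank_of_injective hf

/-- A nilpotent endomorphism of `W` has characteristic polynomial `X ^ dim W`, so Cayley–Hamilton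
applies to the restriction of `T`. -/
lemma pow_finrank_apply_eq_zero {T : Module.End k (Fin n → k)} (hT : IsNilpotent T)
    {W : Submodule k (Fin n → k)} (hW : W.map T ≤ W) :
    W ≤ LinearMap.ker (T ^ Module.finrank k W) := by
  have hmaps : ∀ x ∈ W, T x ∈ W := fun x hx => hW ⟨x, hx, rfl⟩
  have hres : ∀ (m : ℕ) (w : W), ((T.restrict hmaps ^ m) w : Fin n → k) = (T ^ m) w := by
    intro m
    induction m with
    | zero => intro w; rfl
    | succ m ih =>
      intro w
      rw [pow_succ', pow_succ', Module.End.mul_apply, Module.End.mul_apply,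
        LinearMap.restrict_apply]
      change T _ = _
      rw [ih]
  have hnil : IsNilpotent (T.restrict hmaps) := by
    obtain ⟨m, hm⟩ := hT
    exact ⟨m, LinearMap.ext fun w => Subtype.ext (by rw [hres, hm]; rfl)⟩
  have hchar := (LinearMap.charpoly_eq_X_pow_iff (T.restrict hmaps)).2 fun w => by
    obtain ⟨m, hm⟩ := hnil
    exact ⟨m, by rw [hm, LinearMap.zero_apply]⟩
  have h0 := LinearMap.aeval_self_charpoly (T.restrict hmaps)
  rw [hchar, map_pow, Polynomial.aeval_X] at h0
  intro w hw
  rw [LinearMap.mem_ker]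
  have := hres (Module.finrank k W) ⟨w, hw⟩
  rw [h0] at this
  exact this.symm

/-- There is an endomorphism having `W` as its unique invariant subspace of dimension `dim W`. -/
lemma exists_end_unique_invariant (W : Submodule k (Fin n → k)) :
    ∃ T : Module.End k (Fin n → k), W.map T ≤ W ∧ ∀ W' : Submodule k (Fin n → k),
      Module.finrank k W' = Module.finrank k W → W'.map T ≤ W' → W' = W := by
  obtain ⟨C, hC⟩ := Submodule.exists_isCompl W
  obtain ⟨d, hd⟩ : ∃ d, Module.finrank k W = d := ⟨_, rfl⟩
  obtain ⟨e, he⟩ : ∃ e, Module.finrank k C = e := ⟨_, rfl⟩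
  have hn : d + e = n := by
    have := Submodule.finrank_add_eq_of_isCompl hC
    rwa [hd, he, Module.finrank_fin_fun] at this
  subst hn
  let bW : Module.Basis (Fin d) k W := Module.finBasisOfFinrankEq k _ hd
  let bC : Module.Basis (Fin e) k C := Module.finBasisOfFinrankEq k _ he
  let b : Module.Basis (Fin (d + e)) k (Fin (d + e) → k) :=
    ((bW.prod bC).map (Submodule.prodEquivOfIsCompl W C hC)).reindex finSumFinEquiv
  have hbW : ∀ v, v ∈ W ↔ ∀ i : Fin (d + e), d ≤ (i : ℕ) → b.equivFun v i = 0 := by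
    intro v
    have hb : ∀ j, b.equivFun v (Fin.natAdd d j) =
        bC.repr ((Submodule.prodEquivOfIsCompl W C hC).symm v).2 j := by
      intro j
      rw [Module.Basis.equivFun_apply, Module.Basis.repr_reindex_apply, Module.Basis.map_repr,
        finSumFinEquiv_symm_apply_natAdd]
      exact Module.Basis.prod_repr_inr _ _ _ _
    rw [← Submodule.prodEquivOfIsCompl_symm_apply_snd_eq_zero W C hC]
    constructor
    · intro h i hi
      obtain ⟨j, rfl⟩ : ∃ j : Fin e, i = Fin.natAdd d j :=
        ⟨⟨i - d, by omega⟩, Fin.ext (by simp; omega)⟩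
      rw [hb, h, map_zero, Finsupp.zero_apply]
    · intro h
      rw [← bC.repr.map_eq_zero_iff]
      exact Finsupp.ext fun j => (hb j).symm.trans (h _ (by simp))
  let θ := b.equivFun
  let S := shiftEnd k (d + e)
  -- A single nilpotent Jordan block in a basis whose first `d` vectors span `W`.
  let T : Module.End k (Fin (d + e) → k) := θ.symm.toLinearMap ∘ₗ S ∘ₗ θ.toLinearMap
  have hTpow : ∀ m v, (T ^ m) v = θ.symm ((S ^ m) (θ v)) := by
    intro m
    induction m with
    | zero => intro v; simp
    | succ m ih =>
      intro v
      rw [pow_succ', pow_succ', Module.End.mul_apply, Module.End.mul_apply, ih]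
      simp [T]
  have hTW : W.map T ≤ W := by
    rintro _ ⟨w, hw, rfl⟩
    have hw' := (hbW w).1 hw
    rw [hbW]
    intro i hi
    change θ (θ.symm (S (θ w))) i = 0
    rw [θ.apply_symm_apply]
    change (if h : (i : ℕ) + 1 < d + e then θ w ⟨i + 1, h⟩ else 0) = 0
    by_cases h : (i : ℕ) + 1 < d + e
    · rw [dif_pos h]
      exact hw' _ (by simp; omega)
    · rw [dif_neg h]
  have hTnil : IsNilpotent T := by
    refine ⟨d + e, LinearMap.ext fun v => ?_⟩
    rw [hTpow]
    have : (S ^ (d + e)) (θ v) = 0 := by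
      funext i
      rw [shiftEnd_pow_apply, dif_neg (by omega)]
      rfl
    rw [this, map_zero, LinearMap.zero_apply]
  have hker : Module.finrank k (LinearMap.ker (T ^ d)) ≤ d := by
    refine le_trans ?_ (finrank_ker_shiftEnd_pow_le (k := k) (d + e) d)
    have : LinearMap.ker (T ^ d) = (LinearMap.ker (S ^ d)).map θ.symm.toLinearMap := by
      ext v
      rw [LinearMap.mem_ker, hTpow, LinearEquiv.map_eq_zero_iff]
      constructor
      · intro h
        exact ⟨θ v, h, by simp⟩
      · rintro ⟨x, hx, rfl⟩
        simpa using hx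
    rw [this, finrank_map]
  -- The kernel of `T ^ d` has dimension at most `d` and contains every invariant subspace of
  -- dimension `d`, so it equals each of them.
  have huniq : ∀ W' : Submodule k (Fin (d + e) → k), Module.finrank k W' = d →
      W'.map T ≤ W' → W' = LinearMap.ker (T ^ d) := by
    intro W' hW'd hW'
    have hle := pow_finrank_apply_eq_zero hTnil hW'
    rw [hW'd] at hle
    exact Submodule.eq_of_le_of_finrank_le hle (by rw [hW'd]; exact hker)
  exact ⟨T, hTW, fun W' hW'd hW' => by rw [huniq W' (hW'd.trans hd) hW', huniq W hd hTW]⟩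

end OrbitClosures

/-- An irreducible subset of the union lies in one of the two closed pieces, so the pieces are the
maximal irreducible subsets once neither contains the other. -/
lemma componentsOf_union {X : Type*} [TopologicalSpace X] {X₁ X₂ : Set X} (hc₁ : IsClosed X₁)
    (hc₂ : IsClosed X₂) (hi₁ : IsIrreducible X₁) (hi₂ : IsIrreducible X₂) (h₁ : ¬ X₁ ⊆ X₂)
    (h₂ : ¬ X₂ ⊆ X₁) : componentsOf (X₁ ∪ X₂) = {X₁, X₂} := by
  set Z := X₁ ∪ X₂ with hZ
  have hirr : ∀ Y : Set X, Y ⊆ Z → IsIrreducible Y →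
      IsIrreducible (Subtype.val ⁻¹' Y : Set Z) := by
    rintro Y hYZ ⟨⟨y, hy⟩, hY⟩
    refine ⟨⟨⟨y, hYZ hy⟩, hy⟩, ?_⟩
    rintro U V hU hV ⟨a, haY, haU⟩ ⟨b, hbY, hbV⟩
    obtain ⟨U', hU', rfl⟩ := isOpen_induced_iff.1 hU
    obtain ⟨V', hV', rfl⟩ := isOpen_induced_iff.1 hV
    obtain ⟨c, hcY, hc⟩ := hY U' V' hU' hV' ⟨a, haY, haU⟩ ⟨b, hbY, hbV⟩
    exact ⟨⟨c, hYZ hcY⟩, hcY, hc⟩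
  have himage : ∀ Y : Set X, Y ⊆ Z → Subtype.val '' (Subtype.val ⁻¹' Y : Set Z) = Y := by
    intro Y hY
    rw [Subtype.image_preimage_coe, Set.inter_eq_right.2 hY]
  have hcover : ∀ s : Set Z, IsIrreducible s →
      s ⊆ Subtype.val ⁻¹' X₁ ∨ s ⊆ Subtype.val ⁻¹' X₂ := by
    intro s hs
    exact (isPreirreducible_iff_isClosed_union_isClosed.1 hs.2) _ _
      (hc₁.preimage continuous_subtype_val) (hc₂.preimage continuous_subtype_val)
      fun x _ => x.2
  have hsub : ∀ Y Y' : Set X, Y ⊆ Z → (Subtype.val ⁻¹' Y : Set Z) ⊆ Subtype.val ⁻¹' Y' → Y ⊆ Y' :=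
    fun Y Y' hY h y hy => h (a := ⟨y, hY hy⟩) hy
  have hZ₁ : X₁ ⊆ Z := Set.subset_union_left
  have hZ₂ : X₂ ⊆ Z := Set.subset_union_right
  ext Y
  constructor
  · rintro ⟨s, hs, rfl⟩
    rcases hcover s hs.1 with h | h
    · left
      exact (congrArg _ (hs.eq_of_subset (hirr X₁ hZ₁ hi₁) h)).trans (himage _ hZ₁)
    · right
      exact (congrArg _ (hs.eq_of_subset (hirr X₂ hZ₂ hi₂) h)).trans (himage _ hZ₂)
  · rintro (rfl | rfl)
    · refine ⟨Subtype.val ⁻¹' Y, ⟨hirr Y hZ₁ hi₁, fun s hs hle => ?_⟩, himage _ hZ₁⟩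
      exact (hcover s hs).resolve_right fun h => h₁ (hsub _ _ hZ₁ (hle.trans h))
    · refine ⟨Subtype.val ⁻¹' Y, ⟨hirr Y hZ₂ hi₂, fun s hs hle => ?_⟩, himage _ hZ₂⟩
      exact (hcover s hs).resolve_left fun h => h₂ (hsub _ _ hZ₂ (hle.trans h))

/-! ### The two components in the exceptional case. -/

section LagrangianLocus

variable {k : Type*} [Field k] {n r : ℕ} {B : LinearMap.BilinForm k (Fin n → k)}

lemma zero_mem_zSubspace (hB : B.Nondegenerate) (W : Submodule k (Fin n → k)) :
    (fun _ => 0 : EndTuple k n r) ∈ zSubspace r B hB W := by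
  have h : rho B hB 0 = 0 := by
    rw [rho, show LinearMap.dualMap (0 : Module.End k (Fin n → k)) = 0 from map_zero Module.Dual.transpose,
      LinearMap.zero_comp, LinearMap.comp_zero]
  intro i
  rw [h]
  simp

/-- The isotropy rank is at most the dimension, so nothing is removed when `l = d`. -/
lemma zLocus_self (hB : B.Nondegenerate) (d : ℕ) :
    zLocus d d r B hB = ⋃ W ∈ isoGrassmannian B d d, zSubspace r B hB W := by
  have hle : ∀ W : Submodule k (Fin n → k), isotropyRank B W ≤ Module.finrank k W :=
    fun W => Submodule.finrank_mono inf_le_left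
  ext A
  simp only [Set.mem_iUnion, exists_prop]
  constructor
  · rintro ⟨⟨W, hW, hl, hA⟩, -⟩
    exact ⟨W, ⟨hW, le_antisymm ((hle W).trans_eq hW) hl⟩, hA⟩
  · rintro ⟨W, ⟨hW, hl⟩, hA⟩
    refine ⟨⟨W, hW, hl.ge, hA⟩, ?_⟩
    rintro ⟨W', hW', hl', -⟩
    have := hle W'
    omega

/-- The constant tuple at an endomorphism whose only invariant `d`-dimensional subspace is `W` lies
in the first union but not in the second; `0 < r` provides an entry that detects it. -/
lemma not_iUnion_soOrbit_subset (hr : 0 < r) (hB : B.Nondegenerate) (hs : ∀ x y, B x y = B y x)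
    {d : ℕ} (hn : 2 * d = n) {W W' : Submodule k (Fin n → k)} (hW : W ∈ isoGrassmannian B d d)
    (hW' : W' ∈ isoGrassmannian B d d) (h : W ∉ soOrbit B W') :
    ¬ (⋃ U ∈ soOrbit B W, zSubspace r B hB U) ⊆ ⋃ U ∈ soOrbit B W', zSubspace r B hB U := by
  intro hsub
  obtain ⟨T, hT, huniq⟩ := exists_end_unique_invariant W
  have hA : (fun _ => T : EndTuple k n r) ∈ zSubspace r B hB W :=
    mem_zSubspace_of_forall_map_le hB hs (orthogonal_eq_self hB hn hW) fun _ => hT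
  obtain ⟨U, hU, hAU⟩ := Set.mem_iUnion₂.1 (hsub (Set.mem_biUnion (mem_soOrbit_self _) hA))
  have hUd := (mem_isoGrassmannian_of_mem_soOrbit hW' hU).1
  rw [huniq U (hUd.trans hW.1.symm) (hAU ⟨0, hr⟩).1] at hU
  exact h hU

lemma componentsOf_zLocus_self [IsAlgClosed k] (h2 : (2 : k) ≠ 0) (hn0 : 0 < n) (hr : 0 < r)
    (hB : B.Nondegenerate) (hs : B.IsSymm) {d : ℕ} (hn : 2 * d = n)
    (hne : (zLocus d d r B hB).Nonempty) :
    (componentsOf (zLocus d d r B hB)).ncard = 2 ∧ (soOrbits B d d).ncard = 2 ∧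
      componentsOf (zLocus d d r B hB) =
        (fun O : Set (Submodule k (Fin n → k)) => ⋃ W ∈ O, zSubspace r B hB W) ''
          soOrbits B d d := by
  have hs' : ∀ x y, B x y = B y x := fun x y => hs.eq x y
  obtain ⟨W₀, hW₀⟩ : (isoGrassmannian B d d).Nonempty := by
    obtain ⟨A, hA⟩ := hne
    rw [zLocus_self, Set.mem_iUnion₂] at hA
    exact hA.imp fun _ h => h.1
  obtain ⟨v, hv⟩ := exists_anisotropic h2 hn0 hB hs'
  set W₁ := W₀.map (orthReflection B v).toLinearMap
  have hW₁ : W₁ ∈ isoGrassmannian B d d :=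
    map_mem_isoGrassmannian (orthReflection_isometry hs' v) hW₀
  have h10 : W₁ ∉ soOrbit B W₀ := reflection_notMem_soOrbit h2 hB hs' hn hW₀ hv
  have h01 : W₀ ∉ soOrbit B W₁ := fun h => h10 (mem_soOrbit_symm h)
  have horb : soOrbits B d d = {soOrbit B W₀, soOrbit B W₁} := by
    ext O
    constructor
    · rintro ⟨W, hW, rfl⟩
      rcases mem_soOrbit_or_mem_soOrbit h2 hB hs hW₀ hW hv with h | h
      · exact Or.inl (soOrbit_eq_of_mem h)
      · exact Or.inr (soOrbit_eq_of_mem h)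
    · rintro (rfl | rfl)
      · exact ⟨W₀, hW₀, rfl⟩
      · exact ⟨W₁, hW₁, rfl⟩
  have hOne : soOrbit B W₀ ≠ soOrbit B W₁ := fun h => h01 (h ▸ mem_soOrbit_self W₀)
  have hunion : zLocus d d r B hB = (⋃ W ∈ soOrbit B W₀, zSubspace r B hB W) ∪
      ⋃ W ∈ soOrbit B W₁, zSubspace r B hB W := by
    have : isoGrassmannian B d d = soOrbit B W₀ ∪ soOrbit B W₁ := by
      ext W
      refine ⟨fun hW => mem_soOrbit_or_mem_soOrbit h2 hB hs hW₀ hW hv, ?_⟩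
      rintro (h | h)
      · exact mem_isoGrassmannian_of_mem_soOrbit hW₀ h
      · exact mem_isoGrassmannian_of_mem_soOrbit hW₁ h
    rw [zLocus_self, this, Set.biUnion_union]
  have hirr : ∀ W ∈ isoGrassmannian B d d,
      IsIrreducible (⋃ U ∈ soOrbit B W, zSubspace r B hB U) := fun W hW =>
    ⟨⟨_, Set.mem_biUnion (mem_soOrbit_self _) (zero_mem_zSubspace hB W)⟩,
      isPreirreducible_iUnion_soOrbit h2 hn0 hB hs hn hW⟩
  have hsub01 := not_iUnion_soOrbit_subset hr hB hs' hn hW₀ hW₁ h01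
  have hsub10 := not_iUnion_soOrbit_subset hr hB hs' hn hW₁ hW₀ h10
  have hcomp := componentsOf_union (isClosed_iUnion_soOrbit h2 hB hs' hn hW₀)
    (isClosed_iUnion_soOrbit h2 hB hs' hn hW₁) (hirr _ hW₀) (hirr _ hW₁) hsub01 hsub10
  rw [hunion, hcomp, horb, Set.image_pair]
  exact ⟨Set.ncard_pair fun h => hsub01 h.subset, Set.ncard_pair hOne, rfl⟩

end LagrangianLocus

end InvolutionGenerators

theorem mainTheorem6 {k : Type*} [Field k] [IsAlgClosed k] (hchar : ringChar k ≠ 2)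
    {n r : ℕ} (hn : 0 < n) (hr : 0 < r)
    (B : LinearMap.BilinForm k (Fin n → k)) (hB : B.Nondegenerate)
    (hsymm : LinearMap.BilinForm.IsSymm B ∨ InvolutionGenerators.IsSkewSymm B)
    (l d : ℕ) (hne : (InvolutionGenerators.zLocus l d r B hB).Nonempty) :
    (¬ (LinearMap.BilinForm.IsSymm B ∧ 2 * d = n ∧ l = d) →
      IsIrreducible (InvolutionGenerators.zLocus l d r B hB)) ∧
    (LinearMap.BilinForm.IsSymm B ∧ 2 * d = n ∧ l = d →
      (InvolutionGenerators.componentsOf (InvolutionGenerators.zLocus l d r B hB)).ncard = 2 ∧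
      (InvolutionGenerators.soOrbits B d d).ncard = 2 ∧
      InvolutionGenerators.componentsOf (InvolutionGenerators.zLocus l d r B hB) =
        (fun O : Set (Submodule k (Fin n → k)) =>
          ⋃ W ∈ O, InvolutionGenerators.zSubspace r B hB W) ''
            InvolutionGenerators.soOrbits B d d) := by
  have h2 : (2 : k) ≠ 0 := Ring.two_ne_zero hchar
  refine ⟨fun hexc => InvolutionGenerators.isIrreducible_zLocus h2 hB hsymm hne hexc, ?_⟩
  rintro ⟨hs, hd, rfl⟩
  exact InvolutionGenerators.componentsOf_zLocus_self h2 hn hr hB hs hd hne
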